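/- Let $\mathbb S^2\subset\mathbb R^3$ be the unit sphere and let $\gamma:\mathbb S^1\to\mathbb S^2$ be a smooth, regular, simple closed curve that is strictly convex: $\gamma=\partial\Omega$ is the positively oriented boundary of a domain $\Omega\subset\mathbb S^2$ (the enclosed disc), and its geodesic curvature is everywhere positive, $k_g>0$. Here $s$ is arclength, $t=\gamma_s$, positive orientation means that the unit normal $\eta=\gamma\times t$ points into $\Omega$, and $k_g=\langle t_s,\eta\rangle$. Let $L$ be the length of $\gamma$, $A$ the area of $\Omega$, $\|k_g\|_\infty=\sup_\gamma|k_g|$, and $$\bar k_g:=\frac1L\int_\gamma k_g\,ds .$$ Then $$L^{2}-A(4\pi-A)\le\left(\int_{\gamma}\sqrt{1+k_g^{2}}\,ds\right)^{2}-4\pi^{2}-\frac{L}{1+\|k_g\|_\infty^{2}}\int_\gamma (k_g-\bar k_g)^2\,ds .$$ Equality holds if and only if $\gamma$ is a geodesic circle, that is, its image is $\{x\in\mathbb S^2: d(x,p)=r\}$ for some $p\in\mathbb S^2$ and $r\in(0,\pi)$, where $d$ is the geodesic distance. -/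

import Mathlib

open scoped ContDiff Topology

noncomputable section

namespace SphericalCurve

/-- Euclidean three-space. -/
abbrev E3 : Type := EuclideanSpace ℝ (Fin 3)

/-- The unit sphere in Euclidean three-space, as a type. -/
abbrev S2 : Type := Metric.sphere (0 : E3) 1

/-- The cross product on Euclidean three-space. -/
def cross (v w : E3) : E3 :=
  WithLp.toLp 2 (crossProduct (WithLp.ofLp v) (WithLp.ofLp w))

/-- A smooth, regular, simple closed curve on the unit sphere. Maps of the circle `ℝ / 2πℤ` are
represented by `2π`-periodic maps of `ℝ`. -/
structure IsSmoothSimpleClosed (γ : ℝ → E3) : Prop where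
  smooth : ContDiff ℝ ∞ γ
  periodic : Function.Periodic γ (2 * Real.pi)
  mem_sphere : ∀ u, γ u ∈ Metric.sphere (0 : E3) 1
  regular : ∀ u, deriv γ u ≠ 0
  simple : Set.InjOn γ (Set.Ico 0 (2 * Real.pi))

/-- The speed `ds/du`. -/
def speed (γ : ℝ → E3) (u : ℝ) : ℝ := ‖deriv γ u‖

/-- The unit tangent `t = γ_s`. -/
def tangent (γ : ℝ → E3) (u : ℝ) : E3 := (speed γ u)⁻¹ • deriv γ u

/-- The unit normal `η = γ × t` of the curve in the sphere; it points to the left of `γ`. -/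
def normal (γ : ℝ → E3) (u : ℝ) : E3 := cross (γ u) (tangent γ u)

/-- The geodesic curvature `k_g = ⟨t_s, η⟩`, where `∂_s = |γ_u|⁻¹ ∂_u`. -/
def geodesicCurvature (γ : ℝ → E3) (u : ℝ) : ℝ :=
  inner ℝ ((speed γ u)⁻¹ • deriv (tangent γ) u) (normal γ u)

/-- The integral `∫_γ f ds` with respect to arclength. -/
def arcIntegral (γ : ℝ → E3) (f : ℝ → ℝ) : ℝ :=
  ∫ u in (0 : ℝ)..(2 * Real.pi), f u * speed γ u

/-- The length of `γ`. -/
def length (γ : ℝ → E3) : ℝ := arcIntegral γ fun _ => 1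

/-- The mean of the geodesic curvature along `γ`. -/
def meanCurvature (γ : ℝ → E3) : ℝ := (length γ)⁻¹ * arcIntegral γ (geodesicCurvature γ)

/-- The sup norm of the geodesic curvature. -/
def supCurvature (γ : ℝ → E3) : ℝ := ⨆ u, |geodesicCurvature γ u|

/-- `Ω` is the region of the sphere enclosed by `γ`, and `γ` is its positively oriented boundary:
`Ω` is a domain with boundary `γ`, and `η` is the normal of `γ` that points into `Ω` (the geodesic
issuing from `γ u` in direction `η u` enters `Ω`, the one in direction `-η u` stays outside). -/
structure IsEnclosedRegion (γ : ℝ → E3) (Ω : Set S2) : Prop where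
  isOpen : IsOpen Ω
  isConnected : IsConnected Ω
  frontier_eq : frontier Ω = {x : S2 | (x : E3) ∈ Set.range γ}
  inward : ∀ u, ∀ᶠ ε in 𝓝[>] (0 : ℝ),
    Real.cos ε • γ u + Real.sin ε • normal γ u ∈ Subtype.val '' Ω
  outward : ∀ u, ∀ᶠ ε in 𝓝[>] (0 : ℝ),
    Real.cos ε • γ u - Real.sin ε • normal γ u ∉ Subtype.val '' Ω

/-- The area of a region of the unit sphere; the total area of the sphere is `4π`. -/
def area (Ω : Set S2) : ℝ :=
  ((MeasureTheory.volume : MeasureTheory.Measure E3).toSphere Ω).toReal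

/-- The trace of `γ` is a geodesic circle: the set of points of the sphere at a fixed geodesic
distance `r ∈ (0, π)` from a point `p` of the sphere. -/
def IsGeodesicCircle (γ : ℝ → E3) : Prop :=
  ∃ p ∈ Metric.sphere (0 : E3) 1, ∃ r ∈ Set.Ioo 0 Real.pi,
    Set.range γ = {x | x ∈ Metric.sphere (0 : E3) 1 ∧ InnerProductGeometry.angle p x = r}

end SphericalCurve

end

/-
Write `K = ∫ k_g ds`. By Gauss–Bonnet `A = 2π - K`, so `A (4π - A) = 4π² - K²` and the claim reads
`L² + K² + L / (1 + ‖k_g‖²) ∫ (k_g - k̄_g)² ds ≤ (∫ √(1 + k_g²) ds)²`. For `|x|, |y| ≤ M`,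
`√(1 + x²) √(1 + y²) ≥ 1 + x y + (x - y)² / (2 (1 + M²))`. Integrating this with `x = k_g` and
`y = k̄_g`, and squaring, gives the inequality, with equality exactly when `k_g` is constant, that
is, when `γ` is a circle.

Gauss–Bonnet for a strictly convex curve is a volume computation. Let `C` be the cone over `Ω`. By
positivity of `k_g`, a segment in the closure of `C` between non-opposite points of `C` stays in
`C`. As `C` is connected, every point of `C` therefore sees a dense part of `C`, and hence `C` is
the intersection of the half-spaces `⟪x, η⟫ > 0`. Outside `C ∪ -C` and off the lines `ℝ γ(u)`, each
`x` is of the form `a γ(u) + b t(u)` with `b > 0` in exactly one way, because `⟪x, η⟫` changes sign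
as `u` varies. The Jacobian of `(u, a, b) ↦ a γ(u) + b t(u)` is `b k_g ds/du`, so the part of the
unit ball outside `C ∪ -C` has volume `2K/3`. The two cones contribute `A/3` each, and the sum is
`4π/3`.
-/

noncomputable section

open Filter Set MeasureTheory Function Metric Topology
open scoped InnerProductSpace Pointwise ENNReal Real

namespace SphericalCurve

lemma eventually_lt_of_deriv_deriv_pos {f f' : ℝ → ℝ} {x c : ℝ}
    (hf : ∀ u, HasDerivAt f (f' u) u) (hx : f' x = 0) (hf' : HasDerivAt f' c x) (hc : 0 < c) :
    ∀ᶠ u in 𝓝[≠] x, f x < f u := by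
  -- The second derivative test is applied to `f` minus a small multiple of `(u - x) ^ 2`.
  let g : ℝ → ℝ := fun u => f u - c / 4 * (u - x) ^ 2
  have hg : ∀ u, HasDerivAt g (f' u - c / 2 * (u - x)) u := fun u =>
    ((hf u).sub ((((hasDerivAt_id u).sub_const x).pow 2).const_mul (c / 4))).congr_deriv
      (by simp; ring)
  have hg' : deriv g = fun u => f' u - c / 2 * (u - x) := funext fun u => (hg u).deriv
  have hg'' : deriv (deriv g) x = c / 2 := by
    rw [hg']
    exact ((hf'.sub (((hasDerivAt_id x).sub_const x).const_mul (c / 2))).congr_deriv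
      (by ring)).deriv
  have hmin : IsLocalMin g x := isLocalMin_of_deriv_deriv_pos (by rw [hg'']; positivity)
    (by simp [hg', hx]) (hg x).continuousAt
  filter_upwards [hmin.filter_mono nhdsWithin_le_nhds, self_mem_nhdsWithin] with u hu hne
  have : 0 < c / 4 * (u - x) ^ 2 := by
    have := sq_pos_of_ne_zero (sub_ne_zero.2 hne)
    positivity
  have : f x ≤ f u - c / 4 * (u - x) ^ 2 := by simpa [g] using hu
  linarith

lemma periodic_deriv {E : Type*} [NormedAddCommGroup E] [NormedSpace ℝ E] {f : ℝ → E} {T : ℝ}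
    (hf : Periodic f T) : Periodic (deriv f) T := fun u => by
  rw [← deriv_comp_add_const f T u, funext hf]

lemma exists_isMax_of_periodic {f : ℝ → ℝ} {T : ℝ} (hf : Continuous f) (hT : T ≠ 0)
    (hper : Periodic f T) : ∃ x, ∀ u, f u ≤ f x := by
  obtain ⟨_, ⟨x, rfl⟩, hx⟩ :=
    (hper.compact_of_continuous hT hf).exists_isGreatest (range_nonempty f)
  exact ⟨x, fun u => hx ⟨u, rfl⟩⟩

lemma exists_eq_zero_deriv_neg_of_periodic {g g' : ℝ → ℝ} {T a b : ℝ} (hT : 0 < T)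
    (hg : ∀ u, HasDerivAt g (g' u) u) (hper : Periodic g T) (hsimple : ∀ u, g u = 0 → g' u ≠ 0)
    (ha : 0 ≤ g a) (hb : g b ≤ 0) : ∃ u, g u = 0 ∧ g' u < 0 := by
  by_contra! h
  have hbarrier : ∀ u ∈ Ici a, 0 ≤ g u := fun u hu =>
    image_le_of_deriv_right_lt_deriv_boundary (f := fun _ => 0) (f' := fun _ => 0)
      continuousOn_const (fun _ _ => hasDerivWithinAt_const ..) ha hg
      (fun v _ hv => (h v hv.symm).lt_of_ne' (hsimple v hv.symm)) (right_mem_Icc.2 hu)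
  have hnonneg : ∀ u, 0 ≤ g u := fun u => by
    obtain ⟨v, hv, huv⟩ := hper.exists_mem_Ico hT u a
    exact huv ▸ hbarrier v hv.1
  have hb0 : g b = 0 := hb.antisymm (hnonneg b)
  have hmin : IsLocalMin g b := Eventually.of_forall fun u => hb0 ▸ hnonneg u
  exact hsimple b hb0 (hmin.hasDerivAt_eq_zero (hg b))

lemma nhdsWithin_range_eq_map_of_periodic {X : Type*} [TopologicalSpace X] [T2Space X]
    {f : ℝ → X} {T : ℝ} (hT : 0 < T) (hf : Continuous f) (hper : Periodic f T)
    (hinj : InjOn f (Ico 0 T)) (u : ℝ) : 𝓝[range f] (f u) = map f (𝓝 u) := by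
  have : Fact (0 < T) := ⟨hT⟩
  have hlift : IsClosedEmbedding (hper.lift : AddCircle T → X) := by
    refine Continuous.isClosedEmbedding (continuous_quot_lift _ hf) fun x y hxy => ?_
    obtain ⟨a, ha, rfl⟩ := AddCircle.eq_coe_Ico x
    obtain ⟨b, hb, rfl⟩ := AddCircle.eq_coe_Ico y
    exact congrArg _ (hinj ha hb hxy)
  have hrange : range (hper.lift : AddCircle T → X) = range f :=
    (Quotient.mk_surjective.range_comp _).symm
  have hmk : map ((↑) : ℝ → AddCircle T) (𝓝 u) = 𝓝 (u : AddCircle T) :=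
    QuotientAddGroup.isOpenQuotientMap_mk.map_nhds_eq u
  calc 𝓝[range f] (f u) = 𝓝[range hper.lift] (hper.lift (u : AddCircle T)) := by
        rw [hrange]; rfl
    _ = map hper.lift (map (↑) (𝓝 u)) := by rw [hmk, hlift.isInducing.map_nhds_eq]
    _ = map f (𝓝 u) := map_map

lemma sq_sub_le_sqrt_mul_sqrt {x y M : ℝ} (hx : |x| ≤ M) (hy : |y| ≤ M) :
    (x - y) ^ 2 / (2 * (1 + M ^ 2)) ≤ √(1 + x ^ 2) * √(1 + y ^ 2) - 1 - x * y := by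
  set a := √(1 + x ^ 2) * √(1 + y ^ 2)
  have ha : a ^ 2 = (1 + x * y) ^ 2 + (x - y) ^ 2 := by
    rw [mul_pow, Real.sq_sqrt (by positivity), Real.sq_sqrt (by positivity)]
    ring
  have hx2 : x ^ 2 ≤ M ^ 2 := sq_le_sq' (abs_le.1 hx).1 (abs_le.1 hx).2
  have hy2 : y ^ 2 ≤ M ^ 2 := sq_le_sq' (abs_le.1 hy).1 (abs_le.1 hy).2
  have hlower : 1 + x * y ≤ a :=
    le_of_sq_le_sq (by nlinarith [sq_nonneg (x - y)]) (by positivity)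
  have hupper : a ≤ 1 + M ^ 2 := by
    rw [show a = _ from (Real.sqrt_mul (by positivity) _).symm]
    exact Real.sqrt_le_iff.2 ⟨by positivity, by rw [sq (1 + M ^ 2)]; gcongr⟩
  have hsum : a + (1 + x * y) ≤ 2 * (1 + M ^ 2) := by linarith
  rw [div_le_iff₀ (by positivity)]
  calc (x - y) ^ 2 = (a - 1 - x * y) * (a + (1 + x * y)) := by linear_combination -ha
    _ ≤ (a - 1 - x * y) * (2 * (1 + M ^ 2)) := by gcongr; linarith

section Variance

variable {X : Type*} [MeasurableSpace X] {μ : Measure X} [IsFiniteMeasure μ] {k : X → ℝ} {M : ℝ}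

lemma integrable_comp_of_abs_le {f : ℝ → ℝ} (hf : Continuous f) (hk : AEStronglyMeasurable k μ)
    (hM : ∀ᵐ x ∂μ, |k x| ≤ M) : Integrable (fun x => f (k x)) μ := by
  obtain ⟨C, hC⟩ := isCompact_Icc.exists_bound_of_continuousOn hf.continuousOn (s := Icc (-M) M)
  exact .of_bound (hf.comp_aestronglyMeasurable hk) C (hM.mono fun x hx => hC _ (abs_le.1 hx))

lemma integral_sq_sub_div_le {c : ℝ} (hk : AEStronglyMeasurable k μ)
    (hM : ∀ᵐ x ∂μ, |k x| ≤ M) (hc : |c| ≤ M) :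
    (∫ x, (k x - c) ^ 2 ∂μ) / (2 * (1 + M ^ 2)) ≤
      (∫ x, √(1 + k x ^ 2) ∂μ) * √(1 + c ^ 2) - μ.real univ - (∫ x, k x ∂μ) * c := by
  have hint : ∀ f : ℝ → ℝ, Continuous f → Integrable (fun x => f (k x)) μ :=
    fun f hf => integrable_comp_of_abs_le hf hk hM
  calc (∫ x, (k x - c) ^ 2 ∂μ) / (2 * (1 + M ^ 2))
      = ∫ x, (k x - c) ^ 2 / (2 * (1 + M ^ 2)) ∂μ := (integral_div _ _).symm
    _ ≤ ∫ x, (√(1 + k x ^ 2) * √(1 + c ^ 2) - 1 - k x * c) ∂μ :=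
        integral_mono_ae (hint (fun x => (x - c) ^ 2 / _) (by fun_prop))
          (hint (fun x => √(1 + x ^ 2) * √(1 + c ^ 2) - 1 - x * c) (by fun_prop))
          (hM.mono fun x hx => sq_sub_le_sqrt_mul_sqrt hx hc)
    _ = _ := by
        rw [integral_sub (hint (fun x => √(1 + x ^ 2) * √(1 + c ^ 2) - 1) (by fun_prop))
          (hint (fun x => x * c) (by fun_prop)), integral_sub
          (hint (fun x => √(1 + x ^ 2) * √(1 + c ^ 2)) (by fun_prop)) (integrable_const 1),
          integral_mul_const, integral_mul_const]
        simp

lemma abs_average_le (hk : AEStronglyMeasurable k μ) (hM : ∀ᵐ x ∂μ, |k x| ≤ M) (hμ : μ ≠ 0) :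
    |⨍ x, k x ∂μ| ≤ M := by
  have : NeZero μ := ⟨hμ⟩
  exact abs_le.2 ((convex_Icc (-M) M).average_mem isClosed_Icc (hM.mono fun x hx => abs_le.1 hx)
    (integrable_comp_of_abs_le continuous_id hk hM))

lemma sq_measureReal_mul_one_add_sq_average :
    μ.real univ ^ 2 * (1 + (⨍ x, k x ∂μ) ^ 2) = μ.real univ ^ 2 + (∫ x, k x ∂μ) ^ 2 := by
  rw [← measure_smul_average, smul_eq_mul]
  ring

lemma variance_add_le_sq_integral_sqrt (hk : AEStronglyMeasurable k μ)
    (hM : ∀ᵐ x ∂μ, |k x| ≤ M) :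
    μ.real univ ^ 2 + (∫ x, k x ∂μ) ^ 2
        + μ.real univ / (1 + M ^ 2) * ∫ x, (k x - ⨍ y, k y ∂μ) ^ 2 ∂μ
        + ((∫ x, (k x - ⨍ y, k y ∂μ) ^ 2 ∂μ) / (2 * (1 + M ^ 2))) ^ 2 / (1 + (⨍ x, k x ∂μ) ^ 2)
      ≤ (∫ x, √(1 + k x ^ 2) ∂μ) ^ 2 := by
  rcases eq_or_ne μ 0 with rfl | hμ
  · simp
  have h := integral_sq_sub_div_le hk hM (abs_average_le hk hM hμ)
  have hK : ∫ x, k x ∂μ = μ.real univ * ⨍ x, k x ∂μ := by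
    rw [← measure_smul_average, smul_eq_mul]
  rw [← sq_measureReal_mul_one_add_sq_average]
  set m := ⨍ x, k x ∂μ
  set L := μ.real univ
  set v := (∫ x, (k x - m) ^ 2 ∂μ) / (2 * (1 + M ^ 2)) with hv
  have hv0 : 0 ≤ v := by positivity
  have hV : L / (1 + M ^ 2) * ∫ x, (k x - m) ^ 2 ∂μ = 2 * L * v := by
    rw [hv]
    field_simp
  have hq : √(1 + m ^ 2) ^ 2 = 1 + m ^ 2 := Real.sq_sqrt (by positivity)
  calc L ^ 2 * (1 + m ^ 2) + L / (1 + M ^ 2) * ∫ x, (k x - m) ^ 2 ∂μ + v ^ 2 / (1 + m ^ 2)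
      = (L * (1 + m ^ 2) + v) ^ 2 / (1 + m ^ 2) := by
        rw [hV]
        field_simp
        ring
    _ ≤ ((∫ x, √(1 + k x ^ 2) ∂μ) * √(1 + m ^ 2)) ^ 2 / (1 + m ^ 2) := by
        gcongr
        rw [hK] at h
        linarith
    _ = (∫ x, √(1 + k x ^ 2) ∂μ) ^ 2 := by
        rw [mul_pow, hq]
        field_simp

lemma variance_le_sq_integral_sqrt (hk : AEStronglyMeasurable k μ) (hM : ∀ᵐ x ∂μ, |k x| ≤ M) :
    μ.real univ ^ 2 + (∫ x, k x ∂μ) ^ 2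
        + μ.real univ / (1 + M ^ 2) * ∫ x, (k x - ⨍ y, k y ∂μ) ^ 2 ∂μ
      ≤ (∫ x, √(1 + k x ^ 2) ∂μ) ^ 2 :=
  (le_add_of_nonneg_right (by positivity)).trans (variance_add_le_sq_integral_sqrt hk hM)

lemma sq_integral_sqrt_eq_iff (hk : AEStronglyMeasurable k μ) (hM : ∀ᵐ x ∂μ, |k x| ≤ M) :
    (∫ x, √(1 + k x ^ 2) ∂μ) ^ 2 = μ.real univ ^ 2 + (∫ x, k x ∂μ) ^ 2
        + μ.real univ / (1 + M ^ 2) * ∫ x, (k x - ⨍ y, k y ∂μ) ^ 2 ∂μ ↔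
      k =ᵐ[μ] fun _ => ⨍ x, k x ∂μ := by
  have hvar : (∫ x, (k x - ⨍ y, k y ∂μ) ^ 2 ∂μ) = 0 ↔ k =ᵐ[μ] fun _ => ⨍ x, k x ∂μ := by
    rw [integral_eq_zero_iff_of_nonneg (fun x => sq_nonneg _)
      (integrable_comp_of_abs_le (f := fun x => (x - ⨍ y, k y ∂μ) ^ 2) (by fun_prop) hk hM)]
    simp only [EventuallyEq, Pi.zero_apply, sq_eq_zero_iff, sub_eq_zero]
  refine ⟨fun heq => hvar.1 ?_, fun hconst => ?_⟩
  · have h := variance_add_le_sq_integral_sqrt hk hM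
    rw [heq, add_le_iff_nonpos_right] at h
    by_contra hne
    exact h.not_gt (by positivity)
  · have hsqrt : ∫ x, √(1 + k x ^ 2) ∂μ = μ.real univ * √(1 + (⨍ x, k x ∂μ) ^ 2) := by
      rw [integral_congr_ae (hconst.mono fun x hx => by rw [hx])]
      simp
    rw [hvar.2 hconst, hsqrt, mul_pow, Real.sq_sqrt (by positivity),
      sq_measureReal_mul_one_add_sq_average, mul_zero, add_zero]

end Variance

section Cross

open scoped Matrix

lemma inner_eq_dotProduct (x y : E3) : ⟪x, y⟫_ℝ = x.ofLp ⬝ᵥ y.ofLp := by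
  rw [real_inner_comm, EuclideanSpace.inner_eq_star_dotProduct, star_trivial]

/-- The cross product as a continuous bilinear map, which makes it available to calculus. -/
def crossL : E3 →L[ℝ] E3 →L[ℝ] E3 :=
  LinearMap.toContinuousBilinearMap <|
    (crossProduct.compl₁₂ (WithLp.linearEquiv 2 ℝ (Fin 3 → ℝ)).toLinearMap
      (WithLp.linearEquiv 2 ℝ (Fin 3 → ℝ)).toLinearMap).compr₂
        (WithLp.linearEquiv 2 ℝ (Fin 3 → ℝ)).symm.toLinearMap

lemma crossL_apply (v w : E3) : crossL v w = cross v w := rfl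

lemma cross_add_right (a v w : E3) : cross a (v + w) = cross a v + cross a w :=
  (crossL a).map_add v w

lemma cross_smul_right (r : ℝ) (a v : E3) : cross a (r • v) = r • cross a v :=
  (crossL a).map_smul r v

lemma cross_smul_left (r : ℝ) (a v : E3) : cross (r • a) v = r • cross a v := by
  simp only [← crossL_apply, map_smul, FunLike.coe_smul, Pi.smul_apply]

lemma cross_self_eq_zero (a : E3) : cross a a = 0 :=
  congrArg (WithLp.toLp 2) (cross_self a.ofLp)

lemma cross_cross_self (a b : E3) : cross a (cross a b) = ⟪a, b⟫_ℝ • a - ⟪a, a⟫_ℝ • b := by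
  simp only [inner_eq_dotProduct]
  exact congrArg (WithLp.toLp 2) (cross_cross_eq_smul_sub_smul' a.ofLp a.ofLp b.ofLp)

lemma inner_self_cross (a b : E3) : ⟪a, cross a b⟫_ℝ = 0 :=
  (inner_eq_dotProduct _ _).trans (dot_self_cross a.ofLp b.ofLp)

lemma inner_right_cross (a b : E3) : ⟪b, cross a b⟫_ℝ = 0 :=
  (inner_eq_dotProduct _ _).trans (dot_cross_self a.ofLp b.ofLp)

lemma inner_cross_swap (a b c : E3) : ⟪c, cross a b⟫_ℝ = -⟪a, cross c b⟫_ℝ := by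
  simp only [inner_eq_dotProduct, cross]
  rw [triple_product_permutation, ← cross_anticomm c.ofLp b.ofLp, dotProduct_neg]

lemma norm_cross_of_orthonormal {a b : E3} (h : Orthonormal ℝ ![a, b]) : ‖cross a b‖ = 1 := by
  have ha : ‖a‖ = 1 := h.1 0
  have hb : ‖b‖ = 1 := h.1 1
  have hab : ⟪a, b⟫_ℝ = 0 := h.2 zero_ne_one
  have hsq : ⟪cross a b, cross a b⟫_ℝ =
      ⟪a, a⟫_ℝ * ⟪b, b⟫_ℝ - ⟪a, b⟫_ℝ * ⟪b, a⟫_ℝ := by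
    simp only [inner_eq_dotProduct]
    exact cross_dot_cross a.ofLp b.ofLp a.ofLp b.ofLp
  rw [hab, real_inner_self_eq_norm_sq, real_inner_self_eq_norm_sq, real_inner_self_eq_norm_sq,
    ha, hb] at hsq
  exact (pow_eq_one_iff_of_nonneg (norm_nonneg _) two_ne_zero).1 (by linarith)

lemma orthonormal_cross {a b : E3} (h : Orthonormal ℝ ![a, b]) :
    Orthonormal ℝ ![a, b, cross a b] := by
  have hab : ⟪a, b⟫_ℝ = 0 := h.2 zero_ne_one
  refine ⟨fun i => ?_, fun i j hij => ?_⟩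
  · fin_cases i
    exacts [h.1 0, h.1 1, norm_cross_of_orthonormal h]
  · fin_cases i <;> fin_cases j <;>
      simp_all [real_inner_comm a b, real_inner_comm a (cross a b), real_inner_comm b (cross a b),
        inner_self_cross, inner_right_cross]

lemma det_eq_triple_product (T : E3 →L[ℝ] E3) :
    T.det = ⟪T (EuclideanSpace.single 0 1),
      cross (T (EuclideanSpace.single 1 1)) (T (EuclideanSpace.single 2 1))⟫_ℝ := by
  rw [ContinuousLinearMap.det,
    ← LinearMap.det_toMatrix (EuclideanSpace.basisFun (Fin 3) ℝ).toBasis, inner_eq_dotProduct,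
    ← Matrix.det_transpose]
  refine Eq.trans ?_ (triple_product_eq_det _ _ _).symm
  congr 1
  ext i j
  fin_cases i <;> simp [LinearMap.toMatrix_apply]

end Cross

lemma inner_curve_normal (γ : ℝ → E3) (u : ℝ) : ⟪γ u, normal γ u⟫_ℝ = 0 := inner_self_cross _ _

lemma inner_tangent_normal (γ : ℝ → E3) (u : ℝ) : ⟪tangent γ u, normal γ u⟫_ℝ = 0 :=
  inner_right_cross _ _

lemma inner_deriv_eq_zero_of_norm_eq {E : Type*} [NormedAddCommGroup E] [InnerProductSpace ℝ E]
    {f : ℝ → E} {f' : E} {c u : ℝ} (hf : HasDerivAt f f' u) (hc : ∀ v, ‖f v‖ = c) :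
    ⟪f u, f'⟫_ℝ = 0 := by
  have h : HasDerivAt (fun v => ‖f v‖ ^ 2) 0 u := by
    simpa only [hc] using hasDerivAt_const u (c ^ 2)
  simpa using hf.norm_sq.unique h

namespace IsSmoothSimpleClosed

variable {γ : ℝ → E3} (hγ : IsSmoothSimpleClosed γ)
include hγ

lemma norm_curve (u : ℝ) : ‖γ u‖ = 1 := mem_sphere_zero_iff_norm.1 (hγ.mem_sphere u)

lemma curve_ne_zero (u : ℝ) : γ u ≠ 0 := fun h => by simpa [h] using hγ.norm_curve u

lemma speed_pos (u : ℝ) : 0 < speed γ u := norm_pos_iff.2 (hγ.regular u)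

lemma contDiff_deriv : ContDiff ℝ ∞ (deriv γ) := (contDiff_infty_iff_deriv.1 hγ.smooth).2

lemma contDiff_speed : ContDiff ℝ ∞ (speed γ) := hγ.contDiff_deriv.norm ℝ hγ.regular

lemma contDiff_tangent : ContDiff ℝ ∞ (tangent γ) :=
  (hγ.contDiff_speed.inv fun u => (hγ.speed_pos u).ne').smul hγ.contDiff_deriv

lemma contDiff_normal : ContDiff ℝ ∞ (normal γ) :=
  crossL.isBoundedBilinearMap.contDiff.comp (hγ.smooth.prodMk hγ.contDiff_tangent)

lemma continuous_geodesicCurvature : Continuous (geodesicCurvature γ) :=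
  ((hγ.contDiff_speed.continuous.inv₀ fun u => (hγ.speed_pos u).ne').smul
    (contDiff_infty_iff_deriv.1 hγ.contDiff_tangent).2.continuous).inner
    hγ.contDiff_normal.continuous

lemma periodic_speed : Periodic (speed γ) (2 * π) := fun u => by
  rw [speed, periodic_deriv hγ.periodic u, speed]

lemma periodic_tangent : Periodic (tangent γ) (2 * π) := fun u => by
  rw [tangent, hγ.periodic_speed u, periodic_deriv hγ.periodic u, tangent]

lemma periodic_normal : Periodic (normal γ) (2 * π) := fun u => by
  rw [normal, hγ.periodic u, hγ.periodic_tangent u, normal]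

lemma periodic_geodesicCurvature : Periodic (geodesicCurvature γ) (2 * π) := fun u => by
  rw [geodesicCurvature, hγ.periodic_speed u, hγ.periodic_normal u,
    periodic_deriv hγ.periodic_tangent u, geodesicCurvature]

lemma hasDerivAt_curve (u : ℝ) : HasDerivAt γ (speed γ u • tangent γ u) u := by
  rw [tangent, smul_inv_smul₀ (hγ.speed_pos u).ne']
  exact (hγ.smooth.differentiable (by simp) u).hasDerivAt

lemma orthonormal_curve_tangent (u : ℝ) : Orthonormal ℝ ![γ u, tangent γ u] := by
  have hort := inner_deriv_eq_zero_of_norm_eq (hγ.hasDerivAt_curve u) hγ.norm_curve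
  rw [inner_smul_right, mul_eq_zero, or_iff_right (hγ.speed_pos u).ne'] at hort
  have htan : ‖tangent γ u‖ = 1 := norm_smul_inv_norm (hγ.regular u)
  exact orthonormal_vecCons_iff.2 ⟨hγ.norm_curve u, by simpa using hort, by simpa using htan⟩

/-- The Darboux frame `(γ, t, η)` of a spherical curve. -/
def frame (u : ℝ) : OrthonormalBasis (Fin 3) ℝ E3 :=
  (basisOfOrthonormalOfCardEqFinrank (orthonormal_cross (hγ.orthonormal_curve_tangent u))
    (by simp)).toOrthonormalBasis
      (by simpa using orthonormal_cross (hγ.orthonormal_curve_tangent u))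

lemma coe_frame (u : ℝ) : ⇑(hγ.frame u) = ![γ u, tangent γ u, normal γ u] := by
  simp [frame, normal]

lemma norm_tangent (u : ℝ) : ‖tangent γ u‖ = 1 := (hγ.orthonormal_curve_tangent u).1 1

lemma inner_curve_tangent (u : ℝ) : ⟪γ u, tangent γ u⟫_ℝ = 0 :=
  (hγ.orthonormal_curve_tangent u).2 zero_ne_one

lemma norm_normal (u : ℝ) : ‖normal γ u‖ = 1 :=
  norm_cross_of_orthonormal (hγ.orthonormal_curve_tangent u)

lemma eq_sum_frame (u : ℝ) (x : E3) : x =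
    ⟪x, γ u⟫_ℝ • γ u + ⟪x, tangent γ u⟫_ℝ • tangent γ u + ⟪x, normal γ u⟫_ℝ • normal γ u := by
  simpa [coe_frame, Fin.sum_univ_three, real_inner_comm x] using ((hγ.frame u).sum_repr' x).symm

lemma norm_sq_eq_sum_frame (u : ℝ) (x : E3) :
    ‖x‖ ^ 2 = ⟪x, γ u⟫_ℝ ^ 2 + ⟪x, tangent γ u⟫_ℝ ^ 2 + ⟪x, normal γ u⟫_ℝ ^ 2 := by
  simpa [coe_frame, Fin.sum_univ_three] using ((hγ.frame u).sum_sq_norm_inner_left x).symm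

lemma eq_smul_curve {u : ℝ} {x : E3} (ht : ⟪x, tangent γ u⟫_ℝ = 0)
    (hn : ⟪x, normal γ u⟫_ℝ = 0) : x = ⟪x, γ u⟫_ℝ • γ u := by
  simpa [ht, hn] using hγ.eq_sum_frame u x

lemma hasDerivAt_tangent (u : ℝ) : HasDerivAt (tangent γ)
    (speed γ u • (geodesicCurvature γ u • normal γ u - γ u)) u := by
  have ht : HasDerivAt (tangent γ) (deriv (tangent γ) u) u :=
    (hγ.contDiff_tangent.differentiable (by simp) u).hasDerivAt
  have htt : ⟪deriv (tangent γ) u, tangent γ u⟫_ℝ = 0 := by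
    rw [real_inner_comm]
    exact inner_deriv_eq_zero_of_norm_eq ht hγ.norm_tangent
  have htγ : ⟪deriv (tangent γ) u, γ u⟫_ℝ = -speed γ u := by
    have h : HasDerivAt (fun u => ⟪γ u, tangent γ u⟫_ℝ) 0 u := by
      simpa only [hγ.inner_curve_tangent] using hasDerivAt_const u (0 : ℝ)
    have h' := ((hγ.hasDerivAt_curve u).inner ℝ ht).unique h
    rw [real_inner_smul_left, real_inner_self_eq_norm_sq, hγ.norm_tangent] at h'
    rw [real_inner_comm]
    linarith
  have htn : ⟪deriv (tangent γ) u, normal γ u⟫_ℝ = speed γ u * geodesicCurvature γ u := by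
    rw [geodesicCurvature, real_inner_smul_left, mul_inv_cancel_left₀ (hγ.speed_pos u).ne']
  convert ht using 1
  rw [hγ.eq_sum_frame u (deriv (tangent γ) u), htt, htγ, htn]
  module

lemma hasDerivAt_normal (u : ℝ) : HasDerivAt (normal γ)
    (-(speed γ u * geodesicCurvature γ u) • tangent γ u) u := by
  have h := ContinuousLinearMap.hasDerivAt_of_bilinear (B := crossL)
    (fun _ => hγ.hasDerivAt_curve u) (fun _ => hγ.hasDerivAt_tangent u)
  refine h.congr_deriv ?_
  have hγn : cross (γ u) (normal γ u) = -tangent γ u := by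
    rw [normal, cross_cross_self, hγ.inner_curve_tangent, real_inner_self_eq_norm_sq,
      hγ.norm_curve]
    module
  rw [crossL_apply, crossL_apply, cross_smul_right, sub_eq_add_neg, cross_add_right,
    cross_smul_right, hγn, ← neg_one_smul ℝ (γ u), cross_smul_right, cross_self_eq_zero,
    cross_smul_left, cross_self_eq_zero]
  module

lemma hasDerivAt_inner_curve (x : E3) (u : ℝ) :
    HasDerivAt (fun u => ⟪x, γ u⟫_ℝ) (speed γ u * ⟪x, tangent γ u⟫_ℝ) u := by
  simpa [inner_smul_right] using (hasDerivAt_const u x).inner ℝ (hγ.hasDerivAt_curve u)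

lemma hasDerivAt_inner_tangent (x : E3) (u : ℝ) :
    HasDerivAt (fun u => ⟪x, tangent γ u⟫_ℝ)
      (speed γ u * (geodesicCurvature γ u * ⟪x, normal γ u⟫_ℝ - ⟪x, γ u⟫_ℝ)) u := by
  simpa [inner_smul_right, inner_sub_right] using
    (hasDerivAt_const u x).inner ℝ (hγ.hasDerivAt_tangent u)

lemma hasDerivAt_inner_normal (x : E3) (u : ℝ) :
    HasDerivAt (fun u => ⟪x, normal γ u⟫_ℝ)
      (-(speed γ u * geodesicCurvature γ u) * ⟪x, tangent γ u⟫_ℝ) u := by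
  simpa [inner_smul_right] using (hasDerivAt_const u x).inner ℝ (hγ.hasDerivAt_normal u)

end IsSmoothSimpleClosed

/-- The arclength measure of `γ` on one period of the parameter. -/
def arcMeasure (γ : ℝ → E3) : Measure ℝ :=
  (volume.restrict (Ioc 0 (2 * π))).withDensity fun u => ENNReal.ofReal (speed γ u)

namespace IsSmoothSimpleClosed

variable {γ : ℝ → E3} (hγ : IsSmoothSimpleClosed γ)
include hγ

lemma arcIntegral_eq_integral (f : ℝ → ℝ) : arcIntegral γ f = ∫ u, f u ∂arcMeasure γ := by
  rw [arcMeasure, integral_withDensity_eq_integral_toReal_smul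
    hγ.contDiff_speed.continuous.measurable.ennreal_ofReal
    (Eventually.of_forall fun _ => ENNReal.ofReal_lt_top), arcIntegral,
    intervalIntegral.integral_of_le Real.two_pi_pos.le]
  simp only [ENNReal.toReal_ofReal (hγ.speed_pos _).le, smul_eq_mul, mul_comm]

lemma isFiniteMeasure_arcMeasure : IsFiniteMeasure (arcMeasure γ) :=
  isFiniteMeasure_withDensity_ofReal
    (hγ.contDiff_speed.continuous.integrableOn_Ioc (μ := volume)).2

lemma length_eq_measureReal : length γ = (arcMeasure γ).real univ := by
  rw [length, hγ.arcIntegral_eq_integral]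
  simp

lemma meanCurvature_eq_average : meanCurvature γ = ⨍ u, geodesicCurvature γ u ∂arcMeasure γ := by
  rw [meanCurvature, average_eq, hγ.length_eq_measureReal, hγ.arcIntegral_eq_integral, smul_eq_mul]

lemma abs_geodesicCurvature_le (u : ℝ) : |geodesicCurvature γ u| ≤ supCurvature γ := by
  refine le_ciSup (f := fun u => |geodesicCurvature γ u|) ?_ u
  exact (Periodic.compact_of_continuous (hγ.periodic_geodesicCurvature.comp abs)
    Real.two_pi_pos.ne' hγ.continuous_geodesicCurvature.abs).bddAbove

lemma eq_const_of_ae_arcMeasure {f : ℝ → ℝ} {c : ℝ} (hf : Continuous f)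
    (hper : Periodic f (2 * π)) (h : f =ᵐ[arcMeasure γ] fun _ => c) (u : ℝ) : f u = c := by
  have hae : ∀ᵐ u ∂volume.restrict (Ioc 0 (2 * π)), f u = c := by
    rw [EventuallyEq, arcMeasure, ae_withDensity_iff
      hγ.contDiff_speed.continuous.measurable.ennreal_ofReal] at h
    exact h.mono fun u hu => hu (ENNReal.ofReal_pos.2 (hγ.speed_pos u)).ne'
  obtain ⟨v, hv, huv⟩ := hper.exists_mem_Ioc Real.two_pi_pos u 0
  rw [zero_add] at hv
  exact huv.trans
    (Measure.eqOn_Ioc_of_ae_eq volume hae hf.continuousOn continuousOn_const hv)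

end IsSmoothSimpleClosed

lemma isGeodesicCircle_of_range_eq {γ : ℝ → E3} {c : E3} {κ : ℝ} (hκ : |κ| < ‖c‖)
    (h : range γ = {x | x ∈ sphere (0 : E3) 1 ∧ ⟪c, x⟫_ℝ = κ}) : IsGeodesicCircle γ := by
  have hc : 0 < ‖c‖ := (abs_nonneg κ).trans_lt hκ
  have hκc : |κ / ‖c‖| < 1 := by rwa [abs_div, abs_norm, div_lt_one hc]
  obtain ⟨hlo, hhi⟩ := abs_lt.1 hκc
  refine ⟨‖c‖⁻¹ • c, by simp [norm_smul, hc.ne'], Real.arccos (κ / ‖c‖),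
    ⟨Real.arccos_pos.2 hhi, Real.arccos_lt_pi.2 hlo⟩, h.trans ?_⟩
  ext x
  refine and_congr_right fun hx => ?_
  have hx : ‖x‖ = 1 := mem_sphere_zero_iff_norm.1 hx
  have habs := abs_le.1 (abs_real_inner_div_norm_mul_norm_le_one c x)
  rw [InnerProductGeometry.angle_smul_left_of_pos _ _ (inv_pos.2 hc),
    InnerProductGeometry.angle, Real.arccos_inj habs.1 habs.2 hlo.le hhi.le, hx, mul_one,
    div_left_inj' hc.ne']

namespace IsSmoothSimpleClosed

variable {γ : ℝ → E3} (hγ : IsSmoothSimpleClosed γ)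
include hγ

lemma eventually_inner_curve_lt {x : E3} {u : ℝ} (ht : ⟪x, tangent γ u⟫_ℝ = 0)
    (hpos : ⟪x, γ u⟫_ℝ < geodesicCurvature γ u * ⟪x, normal γ u⟫_ℝ) :
    ∀ᶠ v in 𝓝[≠] u, ⟪x, γ u⟫_ℝ < ⟪x, γ v⟫_ℝ := by
  have hs : HasDerivAt (speed γ) (deriv (speed γ) u) u :=
    (hγ.contDiff_speed.differentiable (by simp) u).hasDerivAt
  refine eventually_lt_of_deriv_deriv_pos (hγ.hasDerivAt_inner_curve x) (by rw [ht, mul_zero])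
    (hs.mul (hγ.hasDerivAt_inner_tangent x u)) ?_
  rw [ht, mul_zero, zero_add]
  have := hγ.speed_pos u
  have := sub_pos.2 hpos
  positivity

lemma exists_forall_inner_curve_le (x : E3) : ∃ u, ∀ v, ⟪x, γ v⟫_ℝ ≤ ⟪x, γ u⟫_ℝ :=
  exists_isMax_of_periodic (continuous_const.inner hγ.smooth.continuous) Real.two_pi_pos.ne'
    (hγ.periodic.comp fun y => ⟪x, y⟫_ℝ)

lemma not_forall_inner_curve_le {x : E3} {u : ℝ} (ht : ⟪x, tangent γ u⟫_ℝ = 0)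
    (hpos : ⟪x, γ u⟫_ℝ < geodesicCurvature γ u * ⟪x, normal γ u⟫_ℝ) :
    ¬∀ v, ⟪x, γ v⟫_ℝ ≤ ⟪x, γ u⟫_ℝ := fun h => by
  obtain ⟨v, hv⟩ := (hγ.eventually_inner_curve_lt ht hpos).exists
  exact hv.not_ge (h v)

lemma inner_tangent_eq_zero_of_isMax {x : E3} {u : ℝ} (h : ∀ v, ⟪x, γ v⟫_ℝ ≤ ⟪x, γ u⟫_ℝ) :
    ⟪x, tangent γ u⟫_ℝ = 0 := by
  have hmax : IsLocalMax (fun v => ⟪x, γ v⟫_ℝ) u := Eventually.of_forall h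
  exact (mul_eq_zero.1 (hmax.hasDerivAt_eq_zero (hγ.hasDerivAt_inner_curve x u))).resolve_left
    (hγ.speed_pos u).ne'

lemma exists_smul_add_normal_eq {κ : ℝ} (hκ : ∀ u, geodesicCurvature γ u = κ) :
    ∃ c, ∀ u, κ • γ u + normal γ u = c := by
  have hderiv : ∀ u, HasDerivAt (fun u => κ • γ u + normal γ u) 0 u := fun u =>
    (((hγ.hasDerivAt_curve u).const_smul κ).add (hγ.hasDerivAt_normal u)).congr_deriv
      (by rw [hκ u]; module)
  exact ⟨_, fun u => is_const_of_deriv_eq_zero (fun v => (hderiv v).differentiableAt)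
    (fun v => (hderiv v).deriv) u 0⟩

lemma mem_range_of_inner_eq {κ : ℝ} (hκ : ∀ u, geodesicCurvature γ u = κ) {x : E3}
    (hx : ‖x‖ = 1) (hxκ : ∀ u, ⟪x, κ • γ u + normal γ u⟫_ℝ = κ) : x ∈ range γ := by
  obtain ⟨u, hu⟩ := hγ.exists_forall_inner_curve_le x
  have ht := hγ.inner_tangent_eq_zero_of_isMax hu
  have hn : ⟪x, normal γ u⟫_ℝ = κ * (1 - ⟪x, γ u⟫_ℝ) := by
    have := hxκ u
    rw [inner_add_right, inner_smul_right] at this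
    linarith
  have hsq := hγ.norm_sq_eq_sum_frame u x
  rw [hx, ht, hn] at hsq
  have hfac : (1 - ⟪x, γ u⟫_ℝ) * (κ ^ 2 * (1 - ⟪x, γ u⟫_ℝ) - (1 + ⟪x, γ u⟫_ℝ)) = 0 := by
    linarith
  obtain h1 | h2 := mul_eq_zero.1 hfac
  · refine ⟨u, ?_⟩
    rw [hγ.eq_smul_curve ht (by rw [hn, h1, mul_zero]), ← sub_eq_zero.1 h1, one_smul]
  · -- The other root is the point of the circle farthest from `γ u`.
    refine absurd hu (hγ.not_forall_inner_curve_le ht ?_)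
    rw [hκ u, hn]
    linarith

lemma isGeodesicCircle_of_geodesicCurvature_eq {κ : ℝ} (hκ : ∀ u, geodesicCurvature γ u = κ) :
    IsGeodesicCircle γ := by
  obtain ⟨c, hc⟩ := hγ.exists_smul_add_normal_eq hκ
  have hinner : ∀ u x, ⟪c, x⟫_ℝ = κ * ⟪x, γ u⟫_ℝ + ⟪x, normal γ u⟫_ℝ := fun u x => by
    rw [← hc u, real_inner_comm, inner_add_right, inner_smul_right]
  have hcγ : ∀ u, ⟪c, γ u⟫_ℝ = κ := fun u => by
    rw [hinner u, inner_curve_normal, real_inner_self_eq_norm_sq, hγ.norm_curve]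
    ring
  have hct : ⟪c, tangent γ 0⟫_ℝ = 0 := by
    rw [hinner 0, inner_tangent_normal, real_inner_comm, hγ.inner_curve_tangent]
    ring
  have hcn : ⟪c, normal γ 0⟫_ℝ = 1 := by
    rw [hinner 0, real_inner_comm, inner_curve_normal, real_inner_self_eq_norm_sq,
      hγ.norm_normal]
    ring
  have hnorm : ‖c‖ ^ 2 = κ ^ 2 + 1 := by
    rw [hγ.norm_sq_eq_sum_frame 0, hcγ, hcn, hct]
    ring
  refine isGeodesicCircle_of_range_eq (c := c) (κ := κ)
    (abs_lt_of_sq_lt_sq (by linarith) (norm_nonneg c)) (Subset.antisymm ?_ ?_)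
  · rintro _ ⟨u, rfl⟩
    exact ⟨hγ.mem_sphere u, hcγ u⟩
  · rintro x ⟨hx, hcx⟩
    refine hγ.mem_range_of_inner_eq hκ (mem_sphere_zero_iff_norm.1 hx) fun u => ?_
    rwa [hc u, real_inner_comm]

lemma exists_geodesicCurvature_eq_of_isGeodesicCircle (h : IsGeodesicCircle γ) :
    ∃ κ, ∀ u, geodesicCurvature γ u = κ := by
  obtain ⟨p, hp, r, hr, hrange⟩ := h
  have hγp : ∀ u, ⟪p, γ u⟫_ℝ = Real.cos r := fun u => by
    have hu : InnerProductGeometry.angle p (γ u) = r := by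
      have := mem_range_self (f := γ) u
      rw [hrange] at this
      exact this.2
    rw [← hu, InnerProductGeometry.cos_angle, mem_sphere_zero_iff_norm.1 hp, hγ.norm_curve]
    simp
  have ht : ∀ u, ⟪p, tangent γ u⟫_ℝ = 0 := fun u =>
    hγ.inner_tangent_eq_zero_of_isMax fun v => by rw [hγp, hγp]
  have hn : ∀ u, ⟪p, normal γ u⟫_ℝ = ⟪p, normal γ 0⟫_ℝ := fun u =>
    is_const_of_deriv_eq_zero (fun v => (hγ.hasDerivAt_inner_normal p v).differentiableAt)
      (fun v => by rw [(hγ.hasDerivAt_inner_normal p v).deriv, ht, mul_zero]) u 0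
  have hn0 : ⟪p, normal γ 0⟫_ℝ ≠ 0 := fun h0 => by
    have hsq := hγ.norm_sq_eq_sum_frame 0 p
    rw [mem_sphere_zero_iff_norm.1 hp, hγp, ht, h0] at hsq
    nlinarith [Real.sin_sq_add_cos_sq r, Real.sin_pos_of_mem_Ioo hr]
  refine ⟨Real.cos r / ⟪p, normal γ 0⟫_ℝ, fun u => ?_⟩
  have hder : HasDerivAt (fun v => ⟪p, tangent γ v⟫_ℝ) 0 u := by
    simpa only [ht] using hasDerivAt_const u (0 : ℝ)
  have h0 := (hγ.hasDerivAt_inner_tangent p u).unique hder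
  rw [hn u, hγp u, mul_eq_zero, or_iff_right (hγ.speed_pos u).ne', sub_eq_zero] at h0
  exact eq_div_of_mul_eq hn0 h0

lemma isGeodesicCircle_iff : IsGeodesicCircle γ ↔ ∃ κ, ∀ u, geodesicCurvature γ u = κ :=
  ⟨hγ.exists_geodesicCurvature_eq_of_isGeodesicCircle,
    fun ⟨_, hκ⟩ => hγ.isGeodesicCircle_of_geodesicCurvature_eq hκ⟩

end IsSmoothSimpleClosed

section OpenCone

variable {E : Type*} [NormedAddCommGroup E] [NormedSpace ℝ E] {Ω : Set (sphere (0 : E) 1)}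

/-- The cone, without its apex, over a subset of the unit sphere. -/
def openCone (Ω : Set (sphere (0 : E) 1)) : Set E := Ioi (0 : ℝ) • ((↑) '' Ω : Set E)

lemma smul_mem_openCone {x : E} (hx : x ∈ openCone Ω) {r : ℝ} (hr : 0 < r) :
    r • x ∈ openCone Ω := by
  obtain ⟨s, hs, y, hy, rfl⟩ := hx
  exact ⟨r * s, mul_pos hr hs, y, hy, mul_smul r s y⟩

lemma smul_mem_closure_openCone {x : E} (hx : x ∈ closure (openCone Ω)) {r : ℝ} (hr : 0 < r) :
    r • x ∈ closure (openCone Ω) :=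
  map_mem_closure (continuous_const_smul r) hx fun _ hy => smul_mem_openCone hy hr

lemma isOpen_openCone (hΩ : IsOpen Ω) : IsOpen (openCone Ω) :=
  isOpen_Ioi.smul_sphere one_ne_zero self_notMem_Ioi hΩ

lemma isConnected_openCone (hΩ : IsConnected Ω) : IsConnected (openCone Ω) := by
  rw [openCone, ← image_smul_prod]
  exact (isConnected_Ioi.prod (hΩ.image _ continuous_subtype_val.continuousOn)).image _
    continuous_smul.continuousOn

lemma isOpenEmbedding_polar :
    IsOpenEmbedding fun p : sphere (0 : E) 1 × Ioi (0 : ℝ) => (p.2 : ℝ) • (p.1 : E) :=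
  isOpen_compl_singleton.isOpenEmbedding_subtypeVal.comp
    (homeomorphUnitSphereProd E).symm.isOpenEmbedding

lemma polar_preimage_openCone :
    (fun p : sphere (0 : E) 1 × Ioi (0 : ℝ) => (p.2 : ℝ) • (p.1 : E)) ⁻¹' openCone Ω =
      Ω ×ˢ univ := by
  ext ⟨y, r⟩
  refine ⟨?_, fun h => ⟨r, r.2, y, ⟨y, h.1, rfl⟩, rfl⟩⟩
  rintro ⟨s, hs, _, ⟨z, hz, rfl⟩, h⟩
  have hzy : (z, (⟨s, hs⟩ : Ioi (0 : ℝ))) = (y, r) := isOpenEmbedding_polar.injective h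
  obtain ⟨rfl, -⟩ := Prod.ext_iff.1 hzy
  exact ⟨hz, mem_univ _⟩

lemma smul_mem_openCone_iff {y : sphere (0 : E) 1} {r : ℝ} (hr : 0 < r) :
    r • (y : E) ∈ openCone Ω ↔ y ∈ Ω := by
  have := Set.ext_iff.1 (polar_preimage_openCone (Ω := Ω)) (y, ⟨r, hr⟩)
  simpa using this

lemma smul_mem_frontier_openCone_iff {y : sphere (0 : E) 1} {r : ℝ} (hr : 0 < r) :
    r • (y : E) ∈ frontier (openCone Ω) ↔ y ∈ frontier Ω := by
  have := isOpenEmbedding_polar.isOpenMap.preimage_frontier_eq_frontier_preimage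
    isOpenEmbedding_polar.continuous (openCone Ω)
  rw [polar_preimage_openCone, frontier_prod_univ_eq] at this
  simpa using Set.ext_iff.1 this (y, ⟨r, hr⟩)

lemma zero_notMem_openCone : (0 : E) ∉ openCone Ω := by
  rintro ⟨r, hr, _, ⟨y, -, rfl⟩, h⟩
  exact (smul_ne_zero hr.ne' (ne_zero_of_mem_unit_sphere y)) h

lemma Ioo_smul_eq_openCone_inter_ball :
    Ioo (0 : ℝ) 1 • ((↑) '' Ω : Set E) = openCone Ω ∩ ball 0 1 := by
  have hnorm : ∀ y : sphere (0 : E) 1, ∀ r : ℝ, 0 < r → ‖r • (y : E)‖ = r := fun y r hr => by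
    rw [norm_smul, norm_eq_of_mem_sphere y, mul_one, Real.norm_of_nonneg hr.le]
  ext x
  constructor
  · rintro ⟨r, hr, _, ⟨y, hy, rfl⟩, rfl⟩
    exact ⟨⟨r, hr.1, y, ⟨y, hy, rfl⟩, rfl⟩,
      by simpa only [mem_ball_zero_iff, hnorm y r hr.1] using hr.2⟩
  · rintro ⟨⟨r, hr, _, ⟨y, hy, rfl⟩, rfl⟩, hx⟩
    rw [mem_ball_zero_iff, hnorm y r hr] at hx
    exact ⟨r, ⟨hr, hx⟩, y, ⟨y, hy, rfl⟩, rfl⟩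

lemma toSphere_real_eq_measureReal_openCone [MeasurableSpace E] [BorelSpace E] (μ : Measure E)
    (hΩ : MeasurableSet Ω) :
    μ.toSphere.real Ω = Module.finrank ℝ E * μ.real (openCone Ω ∩ ball 0 1) := by
  rw [measureReal_def, Measure.toSphere_apply' _ hΩ, Ioo_smul_eq_openCone_inter_ball,
    ENNReal.toReal_mul, ENNReal.toReal_natCast, measureReal_def]

end OpenCone

namespace IsEnclosedRegion

variable {γ : ℝ → E3} {Ω : Set S2} (hΩ : IsEnclosedRegion γ Ω)
include hΩ

lemma isOpen_openCone : IsOpen (openCone Ω) := SphericalCurve.isOpen_openCone hΩ.isOpen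

variable (hγ : IsSmoothSimpleClosed γ)
include hγ

lemma mem_frontier_openCone_iff {x : E3} (hx : x ≠ 0) :
    x ∈ frontier (openCone Ω) ↔ ∃ u, ∃ r > (0 : ℝ), x = r • γ u := by
  constructor
  · intro hfr
    let y : S2 := ⟨‖x‖⁻¹ • x, by simp [norm_smul, hx]⟩
    have hxy : x = ‖x‖ • (y : E3) := (smul_inv_smul₀ (norm_ne_zero_iff.2 hx) x).symm
    rw [hxy, smul_mem_frontier_openCone_iff (norm_pos_iff.2 hx), hΩ.frontier_eq] at hfr
    obtain ⟨u, hu⟩ := hfr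
    exact ⟨u, ‖x‖, norm_pos_iff.2 hx, hu ▸ hxy⟩
  · rintro ⟨u, r, hr, rfl⟩
    refine (smul_mem_frontier_openCone_iff (y := ⟨γ u, hγ.mem_sphere u⟩) hr).2 ?_
    rw [hΩ.frontier_eq]
    exact mem_range_self u

lemma curve_mem_frontier_openCone (u : ℝ) : γ u ∈ frontier (openCone Ω) :=
  (hΩ.mem_frontier_openCone_iff hγ (hγ.curve_ne_zero u)).2 ⟨u, 1, one_pos, (one_smul ℝ _).symm⟩

end IsEnclosedRegion

lemma inner_pos_of_eventually_nonneg {E : Type*} [NormedAddCommGroup E] [InnerProductSpace ℝ E]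
    {n p : E} (hn : n ≠ 0) (h : ∀ᶠ q in 𝓝 p, 0 ≤ ⟪q, n⟫_ℝ) : 0 < ⟪p, n⟫_ℝ := by
  refine h.self_of_nhds.lt_of_ne' fun h0 => hn ?_
  have hmin : IsLocalMin (innerSL ℝ n) p := h.mono fun q hq => by
    simpa only [innerSL_apply_apply, real_inner_comm _ n, h0] using hq
  have hzero := hmin.hasFDerivAt_eq_zero (innerSL ℝ n).hasFDerivAt
  exact inner_self_eq_zero.1 (DFunLike.congr_fun hzero n)

lemma disjoint_of_disjoint_frontier {X : Type*} [TopologicalSpace X] {C H : Set X} (hC : IsOpen C)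
    (hH : IsPreconnected H) (hfr : Disjoint H (frontier C)) (hne : (H \ C).Nonempty) :
    Disjoint C H := by
  rw [disjoint_iff_inter_eq_empty, inter_comm, ← not_nonempty_iff_eq_empty]
  intro hmeet
  have hsub : H ⊆ C := hH.subset_of_closure_inter_subset hC hmeet fun p hp =>
    by_contra fun hpC => disjoint_left.1 hfr hp.2 ⟨hp.1, fun hi => hpC (interior_subset hi)⟩
  exact hne.ne_empty (sdiff_eq_empty.2 hsub)

lemma exists_pos_smul_eq_of_sub_eq_smul {E : Type*} [AddCommGroup E] [Module ℝ E] {x y : E}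
    {t c : ℝ} (ht : t ∈ Icc 0 1) (hc : y - x = c • (x + t • (y - x)))
    (h0 : 0 ∉ segment ℝ x y) : ∃ r > (0 : ℝ), x + t • (y - x) = r • x := by
  set z := x + t • (y - x) with hzdef
  have hline : ∀ s : ℝ, x + s • (y - x) = (1 + (s - t) * c) • z := fun s => by
    rw [add_smul, mul_smul, ← hc, one_smul, hzdef]
    module
  have hpos : 0 < 1 - t * c := by
    by_contra! hneg
    have hc0 : 0 < c := pos_of_mul_pos_right (by linarith) ht.1
    have hroot : x + (t - c⁻¹) • (y - x) = 0 := by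
      rw [hline, show 1 + (t - c⁻¹ - t) * c = 0 by field_simp; ring, zero_smul]
    refine h0 (hroot ▸ segment_eq_image' ℝ x y ▸ mem_image_of_mem _ ⟨?_, ?_⟩)
    · rw [sub_nonneg, inv_le_iff_one_le_mul₀ hc0]
      linarith
    · linarith [inv_pos.2 hc0, ht.2]
  refine ⟨(1 - t * c)⁻¹, inv_pos.2 hpos, ?_⟩
  have hx := hline 0
  rw [zero_smul, add_zero, zero_sub, neg_mul, ← sub_eq_add_neg] at hx
  rw [hx, inv_smul_smul₀ hpos.ne']

namespace IsEnclosedRegion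

variable {γ : ℝ → E3} {Ω : Set S2} (hΩ : IsEnclosedRegion γ Ω) (hγ : IsSmoothSimpleClosed γ)
  (hk : ∀ u, 0 < geodesicCurvature γ u)
include hΩ hγ

lemma eventually_outward_notMem_openCone (v : ℝ) : ∀ᶠ ε in 𝓝[>] (0 : ℝ),
    Real.cos ε • γ v - Real.sin ε • normal γ v ∉ openCone Ω := by
  filter_upwards [hΩ.outward v] with ε hε hmem
  have hnorm : ‖Real.cos ε • γ v - Real.sin ε • normal γ v‖ = 1 := by
    refine (pow_eq_one_iff_of_nonneg (norm_nonneg _) two_ne_zero).1 ?_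
    rw [norm_sub_sq_real, norm_smul, norm_smul, hγ.norm_curve, hγ.norm_normal,
      real_inner_smul_left, inner_smul_right, inner_curve_normal]
    simp
  let y : S2 := ⟨_, mem_sphere_zero_iff_norm.2 hnorm⟩
  refine hε ⟨y, (smul_mem_openCone_iff one_pos).1 ?_, rfl⟩
  rwa [one_smul]

lemma exists_mem_ball_inner_normal_neg_notMem_openCone (v : ℝ) {ε : ℝ} (hε : 0 < ε) :
    ∃ p ∈ ball (γ v) ε, ⟪p, normal γ v⟫_ℝ < 0 ∧ p ∉ openCone Ω := by
  have hlim : Tendsto (fun δ => Real.cos δ • γ v - Real.sin δ • normal γ v) (𝓝[>] 0)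
      (𝓝 (γ v)) :=
    (Continuous.tendsto' (by fun_prop) _ _ (by simp)).mono_left nhdsWithin_le_nhds
  obtain ⟨δ, hδC, hδε, hδ⟩ := ((hΩ.eventually_outward_notMem_openCone hγ v).and
    ((hlim.eventually (ball_mem_nhds _ hε)).and (Ioo_mem_nhdsGT Real.pi_pos))).exists
  refine ⟨_, hδε, ?_, hδC⟩
  simpa [inner_sub_left, real_inner_smul_left, inner_curve_normal, hγ.norm_normal] using
    Real.sin_pos_of_mem_Ioo hδ

include hk

lemma eventually_mem_frontier_openCone (v : ℝ) : ∀ᶠ p in 𝓝 (γ v), p ∈ frontier (openCone Ω) →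
    0 < ⟪p, normal γ v⟫_ℝ ∨ ∃ r : ℝ, p = r • γ v := by
  have hne : ∀ᶠ u in 𝓝[≠] v, 0 < ⟪normal γ v, γ u⟫_ℝ := by
    have h := hγ.eventually_inner_curve_lt (x := normal γ v) (u := v)
      (by rw [real_inner_comm, inner_tangent_normal])
      (by rw [real_inner_comm, inner_curve_normal, real_inner_self_eq_norm_sq, hγ.norm_normal]
          simpa using hk v)
    rwa [real_inner_comm, inner_curve_normal] at h
  have hcurve : ∀ᶠ q in 𝓝[range γ] (γ v), q = γ v ∨ 0 < ⟪normal γ v, q⟫_ℝ := by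
    rw [nhdsWithin_range_eq_map_of_periodic Real.two_pi_pos hγ.smooth.continuous hγ.periodic
      hγ.simple, eventually_map]
    filter_upwards [eventually_nhdsWithin_iff.1 hne] with u hu
    exact (eq_or_ne u v).imp (congrArg γ) hu
  have hnormalize : Tendsto (fun p : E3 => ‖p‖⁻¹ • p) (𝓝 (γ v)) (𝓝 (γ v)) := by
    have : ContinuousAt (fun p : E3 => ‖p‖⁻¹ • p) (γ v) :=
      (continuous_norm.continuousAt.inv₀ (norm_ne_zero_iff.2 (hγ.curve_ne_zero v))).smul
        continuousAt_id
    simpa [ContinuousAt, hγ.norm_curve] using this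
  filter_upwards [hnormalize.eventually (eventually_nhdsWithin_iff.1 hcurve),
    isOpen_ne.mem_nhds (hγ.curve_ne_zero v)] with p hp hp0 hfr
  obtain ⟨u, r, hr, rfl⟩ := (hΩ.mem_frontier_openCone_iff hγ hp0).1 hfr
  rw [norm_smul, hγ.norm_curve, mul_one, Real.norm_of_nonneg hr.le, inv_smul_smul₀ hr.ne'] at hp
  obtain h | h := hp (mem_range_self u)
  · exact Or.inr ⟨r, by rw [h]⟩
  · left
    rw [real_inner_comm, inner_smul_right]
    positivity

lemma eventually_inner_normal_nonneg (v : ℝ) : ∀ᶠ p in 𝓝 (γ v), p ∈ closure (openCone Ω) →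
    0 ≤ ⟪p, normal γ v⟫_ℝ := by
  obtain ⟨ε, hε, hball⟩ :=
    Metric.eventually_nhds_iff_ball.1 (hΩ.eventually_mem_frontier_openCone hγ hk v)
  -- The half-ball behind `γ` misses the frontier of the cone and contains a point outside.
  let H : Set E3 := ball (γ v) ε ∩ {p | ⟪p, normal γ v⟫_ℝ < 0}
  have hH : IsPreconnected H := ((convex_ball _ _).inter
    (convex_halfSpace_lt (f := fun p => ⟪p, normal γ v⟫_ℝ)
      ⟨fun x y => inner_add_left x y _, fun c x => real_inner_smul_left x _ c⟩ 0)).isPreconnected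
  have hHopen : IsOpen H :=
    isOpen_ball.inter (isOpen_lt (by fun_prop) continuous_const)
  have hfrontier : ∀ p ∈ H, p ∉ frontier (openCone Ω) := fun p hp hfr => by
    obtain h | ⟨r, rfl⟩ := hball p hp.1 hfr
    · exact (hp.2.trans h).false
    · simpa [real_inner_smul_left, inner_curve_normal] using hp.2
  have hdisj : Disjoint (openCone Ω) H := by
    obtain ⟨p, hpε, hpn, hpC⟩ := hΩ.exists_mem_ball_inner_normal_neg_notMem_openCone hγ v hε
    exact disjoint_of_disjoint_frontier hΩ.isOpen_openCone hH (disjoint_left.2 hfrontier)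
      ⟨p, ⟨hpε, hpn⟩, hpC⟩
  filter_upwards [ball_mem_nhds _ hε] with p hp hcl
  by_contra! hneg
  exact disjoint_left.1 (hdisj.closure_left hHopen) hcl ⟨hp, hneg⟩

lemma eventually_mem_closure_openCone (v : ℝ) : ∀ᶠ p in 𝓝 (γ v), p ∈ closure (openCone Ω) →
    0 < ⟪p, normal γ v⟫_ℝ ∨ ∃ r : ℝ, p = r • γ v := by
  filter_upwards [hΩ.eventually_mem_frontier_openCone hγ hk v,
    eventually_eventually_nhds.2 (hΩ.eventually_inner_normal_nonneg hγ hk v)] with p hfr hnhds hcl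
  by_cases hpC : p ∈ openCone Ω
  · refine Or.inl (inner_pos_of_eventually_nonneg
      (norm_ne_zero_iff.1 (hγ.norm_normal v ▸ one_ne_zero)) ?_)
    filter_upwards [hnhds, hΩ.isOpen_openCone.mem_nhds hpC] with q hq hqC
    exact hq (subset_closure hqC)
  · exact hfr ⟨hcl, fun hi => hpC (interior_subset hi)⟩

lemma exists_eq_smul_of_eventually_mem_closure {z d : E3} (hz : z ∈ frontier (openCone Ω))
    (hz0 : z ≠ 0) (hd : ∀ᶠ τ in 𝓝 (0 : ℝ), z + τ • d ∈ closure (openCone Ω)) :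
    ∃ c : ℝ, d = c • z := by
  obtain ⟨v, r, hr, rfl⟩ := (hΩ.mem_frontier_openCone_iff hγ hz0).1 hz
  have hside : ∀ᶠ τ in 𝓝 (0 : ℝ),
      0 < τ * ⟪d, normal γ v⟫_ℝ ∨ ∃ ρ : ℝ, r • γ v + τ • d = ρ • γ v := by
    have hlim : Tendsto (fun τ : ℝ => r⁻¹ • (r • γ v + τ • d)) (𝓝 0) (𝓝 (γ v)) :=
      Continuous.tendsto' (by fun_prop) _ _ (by simp [hr.ne'])
    filter_upwards [hlim.eventually (hΩ.eventually_mem_closure_openCone hγ hk v), hd] with τ hτ hcl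
    obtain h | ⟨ρ, h⟩ := hτ (smul_mem_closure_openCone hcl (inv_pos.2 hr))
    · left
      simpa [real_inner_smul_left, inner_add_left, inner_curve_normal, hr] using h
    · exact Or.inr ⟨r * ρ, by rw [mul_smul, ← h, smul_inv_smul₀ hr.ne']⟩
  have hside' := (continuous_neg.tendsto' (0 : ℝ) 0 neg_zero).eventually hside
  obtain ⟨τ, ⟨hτ, hτ'⟩, hτ0 : 0 < τ⟩ :=
    ((hside.and hside').filter_mono nhdsWithin_le_nhds |>.and self_mem_nhdsWithin).exists
      (f := 𝓝[>] 0)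
  obtain ⟨σ, hσ0, ρ, hρ⟩ : ∃ σ ≠ (0 : ℝ), ∃ ρ : ℝ, r • γ v + σ • d = ρ • γ v := by
    obtain h | h := hτ
    · obtain h' | h' := hτ'
      · linarith
      · exact ⟨-τ, neg_ne_zero.2 hτ0.ne', h'⟩
    · exact ⟨τ, hτ0.ne', h⟩
  refine ⟨σ⁻¹ * (ρ - r) * r⁻¹, ?_⟩
  rw [smul_smul, inv_mul_cancel_right₀ hr.ne', mul_smul, sub_smul, ← hρ, add_sub_cancel_left,
    inv_smul_smul₀ hσ0]

lemma segment_subset_openCone {x y : E3} (hx : x ∈ openCone Ω) (hy : y ∈ openCone Ω)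
    (hcl : segment ℝ x y ⊆ closure (openCone Ω)) (h0 : 0 ∉ segment ℝ x y) :
    segment ℝ x y ⊆ openCone Ω := by
  intro z hz
  by_contra hzC
  have hzfr : z ∈ frontier (openCone Ω) := ⟨hcl hz, fun hi => hzC (interior_subset hi)⟩
  have hz0 : z ≠ 0 := fun h => h0 (h ▸ hz)
  obtain ⟨t, ht, rfl⟩ := (openSegment_eq_image' ℝ x y ▸
    mem_openSegment_of_ne_left_right (fun h => hzC (h ▸ hx)) (fun h => hzC (h ▸ hy)) hz :
      z ∈ (fun t : ℝ => x + t • (y - x)) '' Ioo 0 1)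
  have hmem : ∀ s ∈ Icc (0 : ℝ) 1, x + s • (y - x) ∈ segment ℝ x y := fun s hs => by
    rw [segment_eq_image']
    exact mem_image_of_mem _ hs
  obtain ⟨c, hc⟩ := hΩ.exists_eq_smul_of_eventually_mem_closure hγ hk hzfr hz0 (d := y - x) (by
    filter_upwards [(continuous_const.add continuous_id).tendsto' (0 : ℝ) t (add_zero t)
      |>.eventually (Icc_mem_nhds ht.1 ht.2)] with τ hτ
    rw [add_assoc, ← add_smul]
    exact hcl (hmem _ hτ))
  obtain ⟨r, hr, hzx⟩ := exists_pos_smul_eq_of_sub_eq_smul (Ioo_subset_Icc_self ht) hc h0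
  exact hzC (mem_of_eq_of_mem hzx (smul_mem_openCone hx hr))

end IsEnclosedRegion

section Visibility

variable {E : Type*} [NormedAddCommGroup E] [NormedSpace ℝ E] {C : Set E} {x y : E}

/-- The set of points that see `x` within `C`. -/
def visibleSet (C : Set E) (x : E) : Set E := {y | segment ℝ x y ⊆ C}

lemma isOpen_visibleSet (hC : IsOpen C) : IsOpen (visibleSet C x) := by
  simp only [isOpen_iff_eventually, visibleSet, segment_eq_image', image_subset_iff, mem_ofPred_eq]
  refine fun y hy => isCompact_Icc.eventually_forall_of_forall_eventually fun t ht => ?_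
  have hcont : Continuous fun p : E × ℝ => x + p.2 • (p.1 - x) := by fun_prop
  exact hcont.continuousAt.eventually (hC.mem_nhds (hy ht))

lemma segment_subset_closure_of_mem_closure_visibleSet (hy : y ∈ closure (visibleSet C x)) :
    segment ℝ x y ⊆ closure C := by
  rintro _ ⟨a, b, ha, hb, hab, rfl⟩
  exact map_mem_closure (f := fun z => a • x + b • z) (by fun_prop) hy
    fun z hz => hz ⟨a, b, ha, hb, hab, rfl⟩

lemma exists_eq_smul_of_zero_mem_segment (hx : x ≠ 0) (h : 0 ∈ segment ℝ x y) :
    ∃ c : ℝ, y = c • x := by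
  obtain ⟨a, b, -, -, hab, h0⟩ := h
  have hb : b ≠ 0 := by
    rintro rfl
    rw [add_zero] at hab
    exact hx (by simpa [hab] using h0)
  exact ⟨-(b⁻¹ * a), by
    rw [neg_smul, mul_smul, ← smul_neg, ← eq_neg_of_add_eq_zero_right h0, inv_smul_smul₀ hb]⟩

lemma dense_compl_span_pair (hE : 2 < Module.finrank ℝ E) (x y : E) :
    Dense ((Submodule.span ℝ {x, y} : Set E)ᶜ) := by
  rw [← interior_eq_empty_iff_dense_compl, ← not_nonempty_iff_eq_empty]
  intro hne
  have htop := Submodule.eq_top_of_nonempty_interior' _ hne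
  have hle := finrank_le_of_span_eq_top (v := ![y, x]) (by simpa using htop)
  simp only [Fintype.card_fin] at hle
  omega

variable (hE : 2 < Module.finrank ℝ E) (hC : IsOpen C) (h0 : 0 ∉ C)
  (hloc : ∀ y ∈ C, segment ℝ x y ⊆ closure C → 0 ∉ segment ℝ x y → segment ℝ x y ⊆ C)
include hE hC h0 hloc

lemma closure_visibleSet_mem_nhds (hyC : y ∈ C) (hy : y ∈ closure (visibleSet C x)) :
    closure (visibleSet C x) ∈ 𝓝 y := by
  obtain ⟨ε, hε, hεC⟩ := Metric.isOpen_iff.1 hC y hyC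
  obtain ⟨y', hy'ε, hy'V⟩ := mem_closure_iff_nhds.1 hy _ (ball_mem_nhds y hε)
  have hx0 : x ≠ 0 := fun h => h0 (h ▸ hy'V (left_mem_segment ℝ x y'))
  -- If `y` is opposite to `x` then `hloc` does not apply to it. But `x` sees every `z` near `y`
  -- outside the plane of `x` and `y'`, since `[y', z]` meets the line of `x` at most in `y'`.
  have hsee : ball y ε ∩ (Submodule.span ℝ {x, y'} : Set E)ᶜ ⊆ visibleSet C x := by
    rintro z ⟨hzε, hz⟩
    have hsub : segment ℝ y' z ⊆ ball y ε := (convex_ball y ε).segment_subset hy'ε hzε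
    refine (convex_segment y' z).isPreconnected.subset_of_closure_inter_subset
      (isOpen_visibleSet hC) ⟨y', left_mem_segment ℝ y' z, hy'V⟩ ?_ (right_mem_segment ℝ y' z)
    rintro w ⟨hwV, hw⟩
    refine hloc w (hεC (hsub hw)) (segment_subset_closure_of_mem_closure_visibleSet hwV)
      fun hw0 => ?_
    obtain ⟨a, b, -, -, hab, rfl⟩ := hw
    obtain ⟨c, hc⟩ := exists_eq_smul_of_zero_mem_segment hx0 hw0
    obtain rfl | hb := eq_or_ne b 0
    · obtain rfl : a = 1 := by simpa using hab
      exact h0 (hy'V (by simpa using hw0))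
    · refine hz (Submodule.mem_span_pair.2 ⟨b⁻¹ * c, -(b⁻¹ * a), ?_⟩)
      rw [mul_smul, ← hc, smul_add, inv_smul_smul₀ hb]
      module
  exact mem_of_superset (ball_mem_nhds y hε)
    (((dense_compl_span_pair hE x y').open_subset_closure_inter isOpen_ball).trans
      (closure_mono hsee))

lemma subset_closure_visibleSet (hconn : IsPreconnected C) (hx : x ∈ C) :
    C ⊆ closure (visibleSet C x) := by
  have hxV : x ∈ visibleSet C x := by simpa [visibleSet] using hx
  have hsub : C ⊆ interior (closure (visibleSet C x)) := by
    refine hconn.subset_of_closure_inter_subset isOpen_interior ⟨x, hx, ?_⟩ fun y hy => ?_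
    · exact interior_maximal subset_closure (isOpen_visibleSet hC) hxV
    · exact mem_interior_iff_mem_nhds.2 (closure_visibleSet_mem_nhds hE hC h0 hloc hy.2
        (closure_minimal interior_subset isClosed_closure hy.1))
  exact hsub.trans interior_subset

end Visibility

lemma convex_forall_inner_pos {E ι : Type*} [NormedAddCommGroup E] [InnerProductSpace ℝ E]
    (n : ι → E) : Convex ℝ {x | ∀ i, 0 < ⟪x, n i⟫_ℝ} := by
  simp only [ofPred_forall]
  exact convex_iInter fun i => convex_halfSpace_gt (f := fun x => ⟪x, n i⟫_ℝ)
    ⟨fun x y => inner_add_left x y _, fun c x => real_inner_smul_left x _ c⟩ 0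

namespace IsSmoothSimpleClosed

variable {γ : ℝ → E3} (hγ : IsSmoothSimpleClosed γ) (hk : ∀ u, 0 < geodesicCurvature γ u)
include hγ hk

lemma eq_zero_of_forall_inner_normal_eq_zero {x : E3} (hx : ∀ u, ⟪x, normal γ u⟫_ℝ = 0) :
    x = 0 := by
  have htan : ∀ u, ⟪x, tangent γ u⟫_ℝ = 0 := fun u => by
    have h := hγ.hasDerivAt_inner_normal x u
    simp only [hx] at h
    exact (mul_eq_zero.1 (h.unique (hasDerivAt_const u 0))).resolve_left
      (neg_ne_zero.2 (mul_pos (hγ.speed_pos u) (hk u)).ne')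
  have hcurve : ⟪x, γ 0⟫_ℝ = 0 := by
    have h := hγ.hasDerivAt_inner_tangent x 0
    simp only [hx, htan, mul_zero, zero_sub] at h
    exact neg_eq_zero.1 ((mul_eq_zero.1 (h.unique (hasDerivAt_const 0 0))).resolve_left
      (hγ.speed_pos 0).ne')
  rw [hγ.eq_smul_curve (htan 0) (hx 0), hcurve, zero_smul]

end IsSmoothSimpleClosed

namespace IsEnclosedRegion

variable {γ : ℝ → E3} {Ω : Set S2} (hΩ : IsEnclosedRegion γ Ω) (hγ : IsSmoothSimpleClosed γ)
  (hk : ∀ u, 0 < geodesicCurvature γ u)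
include hΩ hγ hk

lemma segment_subset_closure_openCone {x : E3} (hx : x ∈ openCone Ω) (u : ℝ) :
    segment ℝ x (γ u) ⊆ closure (openCone Ω) :=
  segment_subset_closure_of_mem_closure_visibleSet <|
    closure_minimal (subset_closure_visibleSet (by simp) hΩ.isOpen_openCone zero_notMem_openCone
      (fun _ hy => hΩ.segment_subset_openCone hγ hk hx hy)
      (isConnected_openCone hΩ.isConnected).isPreconnected hx) isClosed_closure
      (hΩ.curve_mem_frontier_openCone hγ u).1

lemma inner_normal_nonneg {x : E3} (hx : x ∈ closure (openCone Ω)) (u : ℝ) :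
    0 ≤ ⟪x, normal γ u⟫_ℝ := by
  suffices h : openCone Ω ⊆ {x | 0 ≤ ⟪x, normal γ u⟫_ℝ} from
    closure_minimal h (isClosed_le continuous_const (by fun_prop)) hx
  intro x hx
  have hlim : Tendsto (fun τ : ℝ => γ u + τ • (x - γ u)) (𝓝[>] 0) (𝓝 (γ u)) :=
    (Continuous.tendsto' (by fun_prop) _ _ (by simp)).mono_left nhdsWithin_le_nhds
  obtain ⟨τ, hτ, hτ01⟩ := ((hlim.eventually (hΩ.eventually_inner_normal_nonneg hγ hk u)).and
    (Ioo_mem_nhdsGT one_pos)).exists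
  have hseg : γ u + τ • (x - γ u) ∈ segment ℝ x (γ u) := by
    rw [segment_symm, segment_eq_image']
    exact mem_image_of_mem _ (Ioo_subset_Icc_self hτ01)
  have h := hτ (hΩ.segment_subset_closure_openCone hγ hk hx u hseg)
  simp only [inner_add_left, real_inner_smul_left, inner_sub_left, inner_curve_normal, sub_zero,
    zero_add] at h
  exact nonneg_of_mul_nonneg_right h hτ01.1

lemma inner_normal_pos {x : E3} (hx : x ∈ openCone Ω) (u : ℝ) : 0 < ⟪x, normal γ u⟫_ℝ :=
  inner_pos_of_eventually_nonneg (norm_ne_zero_iff.1 (hγ.norm_normal u ▸ one_ne_zero)) <|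
    mem_of_superset (hΩ.isOpen_openCone.mem_nhds hx) fun _ hq =>
      hΩ.inner_normal_nonneg hγ hk (subset_closure hq) u

lemma openCone_eq : openCone Ω = {x | ∀ u, 0 < ⟪x, normal γ u⟫_ℝ} := by
  refine Subset.antisymm (fun x hx => hΩ.inner_normal_pos hγ hk hx) ?_
  have hfr : Disjoint {x : E3 | ∀ u, 0 < ⟪x, normal γ u⟫_ℝ} (frontier (openCone Ω)) := by
    refine disjoint_left.2 fun x hx hxfr => ?_
    obtain ⟨u, r, -, rfl⟩ := (hΩ.mem_frontier_openCone_iff hγ fun h => by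
      simpa [h] using hx 0).1 hxfr
    simpa [real_inner_smul_left, inner_curve_normal] using hx u
  by_contra hsub
  have hdisj := disjoint_of_disjoint_frontier hΩ.isOpen_openCone
    (convex_forall_inner_pos (normal γ)).isPreconnected hfr (sdiff_nonempty.2 hsub)
  obtain ⟨x, hx⟩ := (isConnected_openCone hΩ.isConnected).nonempty
  exact disjoint_left.1 hdisj hx (hΩ.inner_normal_pos hγ hk hx)

lemma convex_openCone : Convex ℝ (openCone Ω) :=
  hΩ.openCone_eq hγ hk ▸ convex_forall_inner_pos (normal γ)

lemma eq_of_inner_normal_eq_zero {u v : ℝ} (h : ⟪γ v, normal γ u⟫_ℝ = 0) : γ v = γ u := by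
  have hnonneg : ∀ v w, 0 ≤ ⟪γ v, normal γ w⟫_ℝ := fun v =>
    hΩ.inner_normal_nonneg hγ hk (hΩ.curve_mem_frontier_openCone hγ v).1
  have hmin : IsLocalMin (fun w => ⟪γ v, normal γ w⟫_ℝ) u :=
    Eventually.of_forall fun w => h.trans_le (hnonneg v w)
  have htan : ⟪γ v, tangent γ u⟫_ℝ = 0 :=
    (mul_eq_zero.1 (hmin.hasDerivAt_eq_zero (hγ.hasDerivAt_inner_normal (γ v) u))).resolve_left
      (neg_ne_zero.2 (mul_pos (hγ.speed_pos u) (hk u)).ne')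
  have hsq : ⟪γ v, γ u⟫_ℝ ^ 2 = 1 := by
    simpa [h, htan, hγ.norm_curve] using (hγ.norm_sq_eq_sum_frame u (γ v)).symm
  have hsmul := hγ.eq_smul_curve htan h
  obtain h1 | h1 := sq_eq_one_iff.1 hsq <;> rw [h1] at hsmul
  · rw [hsmul, one_smul]
  · refine absurd (hγ.eq_zero_of_forall_inner_normal_eq_zero hk fun w => ?_)
      (hγ.curve_ne_zero u)
    have hneg := hnonneg v w
    rw [hsmul, neg_one_smul, inner_neg_left] at hneg
    linarith [hnonneg u w]

end IsEnclosedRegion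

/-- The parametrization `(u, a, b) ↦ a γ(u) + b t(u)` of the tangent planes of the cone over `γ`. -/
def tangentMap (γ : ℝ → E3) (p : E3) : E3 := p 1 • γ (p 0) + p 2 • tangent γ (p 0)

/-- The parameters of the points of the unit ball that lie ahead of the point of contact in a
tangent plane; each `u` contributes an open half-disk of radius one. -/
def tangentDomain : Set E3 := {p | p 0 ∈ Ico 0 (2 * π) ∧ 0 < p 2 ∧ p 1 ^ 2 + p 2 ^ 2 < 1}

/-- The derivative of `tangentMap`, read off from the Frenet equations. -/
def tangentMapDeriv (γ : ℝ → E3) (p : E3) : E3 →L[ℝ] E3 :=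
  (EuclideanSpace.proj (𝕜 := ℝ) (0 : Fin 3)).smulRight
      (p 1 • speed γ (p 0) • tangent γ (p 0) +
        p 2 • speed γ (p 0) • (geodesicCurvature γ (p 0) • normal γ (p 0) - γ (p 0))) +
    (EuclideanSpace.proj (𝕜 := ℝ) (1 : Fin 3)).smulRight (γ (p 0)) +
    (EuclideanSpace.proj (𝕜 := ℝ) (2 : Fin 3)).smulRight (tangent γ (p 0))

lemma inner_tangentMap_normal (γ : ℝ → E3) (p : E3) : ⟪tangentMap γ p, normal γ (p 0)⟫_ℝ = 0 := by
  rw [tangentMap, inner_add_left, real_inner_smul_left, real_inner_smul_left, inner_curve_normal,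
    inner_tangent_normal, mul_zero, mul_zero, add_zero]

lemma cross_tangentMap (γ : ℝ → E3) (p : E3) :
    cross (γ (p 0)) (tangentMap γ p) = p 2 • normal γ (p 0) := by
  rw [tangentMap, cross_add_right, cross_smul_right, cross_smul_right, cross_self_eq_zero,
    smul_zero, zero_add, normal]

namespace IsSmoothSimpleClosed

variable {γ : ℝ → E3} (hγ : IsSmoothSimpleClosed γ)
include hγ

lemma inner_tangentMap_curve (p : E3) : ⟪tangentMap γ p, γ (p 0)⟫_ℝ = p 1 := by
  rw [tangentMap, inner_add_left, real_inner_smul_left, real_inner_smul_left,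
    real_inner_self_eq_norm_sq, hγ.norm_curve, real_inner_comm, hγ.inner_curve_tangent]
  simp

lemma inner_tangentMap_tangent (p : E3) : ⟪tangentMap γ p, tangent γ (p 0)⟫_ℝ = p 2 := by
  rw [tangentMap, inner_add_left, real_inner_smul_left, real_inner_smul_left,
    real_inner_self_eq_norm_sq, hγ.norm_tangent, hγ.inner_curve_tangent]
  simp

lemma norm_sq_tangentMap (p : E3) : ‖tangentMap γ p‖ ^ 2 = p 1 ^ 2 + p 2 ^ 2 := by
  rw [hγ.norm_sq_eq_sum_frame (p 0), hγ.inner_tangentMap_curve, hγ.inner_tangentMap_tangent,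
    inner_tangentMap_normal, zero_pow two_ne_zero, add_zero]

lemma tangentMap_mem_ball {p : E3} (hp : p ∈ tangentDomain) : tangentMap γ p ∈ ball (0 : E3) 1 := by
  rw [mem_ball_zero_iff, ← sq_lt_one_iff₀ (norm_nonneg _), hγ.norm_sq_tangentMap]
  exact hp.2.2

lemma hasFDerivAt_tangentMap (p : E3) :
    HasFDerivAt (tangentMap γ) (tangentMapDeriv γ p) p := by
  have hproj : ∀ i : Fin 3, HasFDerivAt (fun p : E3 => p i) (EuclideanSpace.proj (𝕜 := ℝ) i) p :=
    fun i => (EuclideanSpace.proj (𝕜 := ℝ) i).hasFDerivAt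
  have hcurve := (hproj 1).fun_smul
    ((hγ.hasDerivAt_curve (p 0)).hasFDerivAt.comp p (hproj 0))
  have htangent := (hproj 2).fun_smul
    ((hγ.hasDerivAt_tangent (p 0)).hasFDerivAt.comp p (hproj 0))
  refine (hcurve.add htangent).congr_fderiv (ContinuousLinearMap.ext fun v => ?_)
  simp only [tangentMapDeriv, add_apply, smul_apply,
    ContinuousLinearMap.comp_apply, ContinuousLinearMap.smulRight_apply,
    ContinuousLinearMap.toSpanSingleton_apply, PiLp.proj_apply, comp_apply]
  module

lemma det_tangentMapDeriv (p : E3) :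
    (tangentMapDeriv γ p).det = p 2 * (geodesicCurvature γ (p 0) * speed γ (p 0)) := by
  have hcurve : tangentMapDeriv γ p (EuclideanSpace.single 1 1) = γ (p 0) := by
    simp [tangentMapDeriv]
  have htangent : tangentMapDeriv γ p (EuclideanSpace.single 2 1) = tangent γ (p 0) := by
    simp [tangentMapDeriv]
  have hu : tangentMapDeriv γ p (EuclideanSpace.single 0 1) =
      p 1 • speed γ (p 0) • tangent γ (p 0) +
        p 2 • speed γ (p 0) • (geodesicCurvature γ (p 0) • normal γ (p 0) - γ (p 0)) := by
    simp [tangentMapDeriv]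
  rw [det_eq_triple_product, hu, hcurve, htangent, ← normal]
  simp only [inner_add_left, real_inner_smul_left, inner_sub_left, inner_curve_normal,
    inner_tangent_normal, real_inner_self_eq_norm_sq, hγ.norm_normal]
  ring

variable (hk : ∀ u, 0 < geodesicCurvature γ u)
include hk

lemma exists_inner_normal_eq_zero {x : E3} (hx : ∀ u, ∀ r : ℝ, x ≠ r • γ u)
    {u₁ u₂ : ℝ} (h₁ : ⟪x, normal γ u₁⟫_ℝ ≤ 0) (h₂ : 0 ≤ ⟪x, normal γ u₂⟫_ℝ) :
    ∃ u, ⟪x, normal γ u⟫_ℝ = 0 ∧ 0 < ⟪x, tangent γ u⟫_ℝ := by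
  have hpos : ∀ u, 0 < speed γ u * geodesicCurvature γ u := fun u =>
    mul_pos (hγ.speed_pos u) (hk u)
  obtain ⟨u, hu, hneg⟩ := exists_eq_zero_deriv_neg_of_periodic Real.two_pi_pos
    (hγ.hasDerivAt_inner_normal x) (fun u => by simp only [hγ.periodic_normal u])
    (fun u hn hz => hx u _ (hγ.eq_smul_curve
      ((mul_eq_zero.1 hz).resolve_left (neg_ne_zero.2 (hpos u).ne')) hn)) h₂ h₁
  refine ⟨u, hu, pos_of_mul_pos_right ?_ (hpos u).le⟩
  rwa [neg_mul, neg_lt_zero] at hneg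

end IsSmoothSimpleClosed

namespace IsEnclosedRegion

variable {γ : ℝ → E3} {Ω : Set S2} (hΩ : IsEnclosedRegion γ Ω) (hγ : IsSmoothSimpleClosed γ)
  (hk : ∀ u, 0 < geodesicCurvature γ u)
include hΩ hγ hk

lemma injOn_tangentMap : InjOn (tangentMap γ) tangentDomain := by
  rintro p ⟨hp0, hp2, -⟩ q ⟨hq0, hq2, -⟩ hpq
  have hnonneg : ∀ v u, 0 ≤ ⟪γ v, normal γ u⟫_ℝ := fun v =>
    hΩ.inner_normal_nonneg hγ hk (hΩ.curve_mem_frontier_openCone hγ v).1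
  -- `p 2 * ⟪γ (q 0), normal γ (p 0)⟫` is the determinant of `γ (p 0)`, the common value, `γ (q 0)`.
  -- Exchanging `p` and `q` changes its sign, although it is nonnegative for both orders.
  have hswap := inner_cross_swap (γ (p 0)) (tangentMap γ p) (γ (q 0))
  rw [cross_tangentMap, hpq, cross_tangentMap, inner_smul_right, inner_smul_right] at hswap
  have hzero : p 2 * ⟪γ (q 0), normal γ (p 0)⟫_ℝ = 0 :=
    le_antisymm (by linarith [mul_nonneg hq2.le (hnonneg (p 0) (q 0))])
      (mul_nonneg hp2.le (hnonneg (q 0) (p 0)))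
  have h0 : q 0 = p 0 := hγ.simple hq0 hp0
    (hΩ.eq_of_inner_normal_eq_zero hγ hk ((mul_eq_zero.1 hzero).resolve_left hp2.ne'))
  ext i
  fin_cases i
  · exact h0.symm
  · change p 1 = q 1
    rw [← hγ.inner_tangentMap_curve p, ← hγ.inner_tangentMap_curve q, hpq, h0]
  · change p 2 = q 2
    rw [← hγ.inner_tangentMap_tangent p, ← hγ.inner_tangentMap_tangent q, hpq, h0]

lemma mem_image_tangentMap {x : E3} (hx : x ∈ ball 0 1) (hC : x ∉ openCone Ω)
    (hC' : -x ∉ openCone Ω) (hline : ∀ u, ∀ r : ℝ, x ≠ r • γ u) :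
    x ∈ tangentMap γ '' tangentDomain := by
  simp only [hΩ.openCone_eq hγ hk, mem_ofPred_eq, inner_neg_left, not_forall, not_lt,
    neg_nonpos] at hC hC'
  obtain ⟨u₁, h₁⟩ := hC
  obtain ⟨u₂, h₂⟩ := hC'
  obtain ⟨u, hn, ht⟩ := hγ.exists_inner_normal_eq_zero hk hline h₁ h₂
  obtain ⟨v, hv, hframe⟩ := (show Periodic (fun u => (normal γ u, tangent γ u)) (2 * π) from
    fun u => by simp only [hγ.periodic_normal u, hγ.periodic_tangent u]).exists_mem_Ico₀
      Real.two_pi_pos u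
  obtain ⟨hnv, htv⟩ := Prod.ext_iff.1 hframe
  simp only at hnv htv
  rw [hnv] at hn
  rw [htv] at ht
  have hmap : tangentMap γ !₂[v, ⟪x, γ v⟫_ℝ, ⟪x, tangent γ v⟫_ℝ] = x := by
    simpa [tangentMap, hn] using (hγ.eq_sum_frame v x).symm
  refine ⟨_, ⟨hv, ht, ?_⟩, hmap⟩
  rw [← hγ.norm_sq_tangentMap, hmap, sq_lt_one_iff₀ (norm_nonneg x)]
  exact mem_ball_zero_iff.1 hx

end IsEnclosedRegion

lemma lintegral_Ioo_zero_ofReal {c : ℝ} (hc : 0 ≤ c) :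
    ∫⁻ b in Ioo 0 c, ENNReal.ofReal b = ENNReal.ofReal (c ^ 2 / 2) := by
  rw [← ofReal_integral_eq_lintegral_ofReal, ← integral_Ioc_eq_integral_Ioo,
    ← intervalIntegral.integral_of_le hc, integral_id, zero_pow two_ne_zero, sub_zero]
  · exact continuous_id.integrableOn_Icc.mono_set Ioo_subset_Icc_self
  · exact (ae_restrict_mem measurableSet_Ioo).mono fun b hb => hb.1.le

/-- The open upper half of the unit disk. -/
def halfDisk : Set (ℝ × ℝ) := {q | 0 < q.2 ∧ q.1 ^ 2 + q.2 ^ 2 < 1}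

lemma measurableSet_halfDisk : MeasurableSet halfDisk :=
  ((isOpen_lt continuous_const continuous_snd).inter
    (isOpen_lt (by fun_prop : Continuous fun q : ℝ × ℝ => q.1 ^ 2 + q.2 ^ 2)
      continuous_const)).measurableSet

lemma preimage_mk_halfDisk (a : ℝ) : Prod.mk a ⁻¹' halfDisk = Ioo 0 √(1 - a ^ 2) := by
  ext b
  refine and_congr_right fun hb => ?_
  rw [Real.lt_sqrt (le_of_lt hb), lt_sub_iff_add_lt']

lemma lintegral_indicator_halfDisk (a : ℝ) :
    ∫⁻ b, halfDisk.indicator (fun q => ENNReal.ofReal q.2) (a, b) =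
      (Icc (-1 : ℝ) 1).indicator (fun a => ENNReal.ofReal ((1 - a ^ 2) / 2)) a := by
  change ∫⁻ b, (Prod.mk a ⁻¹' halfDisk).indicator ENNReal.ofReal b = _
  rw [preimage_mk_halfDisk, lintegral_indicator measurableSet_Ioo,
    lintegral_Ioo_zero_ofReal (Real.sqrt_nonneg _), indicator_apply]
  split_ifs with ha
  · rw [Real.sq_sqrt (sub_nonneg.2 ((sq_le_one_iff_abs_le_one a).2 (abs_le.2 ha)))]
  · have hneg : 1 - a ^ 2 ≤ 0 := by
      by_contra! h
      exact ha (abs_le.1 ((sq_le_one_iff_abs_le_one a).1 (by linarith)))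
    rw [Real.sqrt_eq_zero_of_nonpos hneg, zero_pow two_ne_zero, zero_div, ENNReal.ofReal_zero]

lemma lintegral_halfDisk : ∫⁻ q in halfDisk, ENNReal.ofReal q.2 = ENNReal.ofReal (2 / 3) := by
  rw [← lintegral_indicator measurableSet_halfDisk, Measure.volume_eq_prod,
    lintegral_prod _ ((by fun_prop : Measurable fun q : ℝ × ℝ => ENNReal.ofReal q.2).indicator
      measurableSet_halfDisk).aemeasurable]
  simp only [lintegral_indicator_halfDisk]
  rw [lintegral_indicator measurableSet_Icc, ← ofReal_integral_eq_lintegral_ofReal,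
    integral_Icc_eq_integral_Ioc, ← intervalIntegral.integral_of_le (by norm_num)]
  · rw [intervalIntegral.integral_div, intervalIntegral.integral_sub (by simp) (by simp),
      integral_one, integral_pow]
    norm_num
  · exact Continuous.integrableOn_Icc (by fun_prop)
  · refine (ae_restrict_mem measurableSet_Icc).mono fun a ha => div_nonneg ?_ zero_le_two
    exact sub_nonneg.2 ((sq_le_one_iff_abs_le_one a).2 (abs_le.2 ha))

/-- The identification of Euclidean three-space with `ℝ × ℝ²`, used to integrate over half-disks. -/
def toTriple (p : E3) : ℝ × ℝ × ℝ := (p 0, p 1, p 2)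

lemma measurePreserving_toTriple : MeasurePreserving toTriple :=
  ((MeasurePreserving.id (volume : Measure ℝ)).prod (volume_preserving_finTwoArrow ℝ)).comp
    ((volume_preserving_piFinSuccAbove (fun _ : Fin 3 => ℝ) 0).comp
      (PiLp.volume_preserving_ofLp (Fin 3)))

lemma tangentDomain_eq_preimage :
    tangentDomain = toTriple ⁻¹' (Ico 0 (2 * π) ×ˢ halfDisk) := rfl

lemma measurableSet_tangentDomain : MeasurableSet tangentDomain :=
  measurePreserving_toTriple.measurable (measurableSet_Ico.prod measurableSet_halfDisk)

lemma lintegral_tangentDomain {f : ℝ → ℝ} (hf : Continuous f) (hf0 : ∀ u, 0 ≤ f u) :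
    ∫⁻ p in tangentDomain, ENNReal.ofReal (p 2 * f (p 0)) =
      ENNReal.ofReal (2 / 3 * ∫ u in (0 : ℝ)..(2 * π), f u) := by
  let F : ℝ × ℝ × ℝ → ℝ≥0∞ := fun q => ENNReal.ofReal (f q.1) * ENNReal.ofReal q.2.2
  have hF : Measurable F := by
    have := hf.measurable
    fun_prop
  calc ∫⁻ p in tangentDomain, ENNReal.ofReal (p 2 * f (p 0))
      = ∫⁻ p in tangentDomain, F (toTriple p) := by
        refine lintegral_congr fun p => ?_
        rw [mul_comm, ENNReal.ofReal_mul (hf0 _)]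
        rfl
    _ = ∫⁻ q, F q ∂(volume.restrict (Ico 0 (2 * π))).prod (volume.restrict halfDisk) := by
        rw [tangentDomain_eq_preimage, measurePreserving_toTriple.setLIntegral_comp_preimage
          (measurableSet_Ico.prod measurableSet_halfDisk) hF, Measure.volume_eq_prod,
          Measure.prod_restrict]
    _ = (∫⁻ u in Ico 0 (2 * π), ENNReal.ofReal (f u)) * ENNReal.ofReal (2 / 3) := by
        rw [← lintegral_halfDisk]
        exact lintegral_prod_mul hf.measurable.ennreal_ofReal.aemeasurable
          (by fun_prop : Measurable fun q : ℝ × ℝ => ENNReal.ofReal q.2).aemeasurable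
    _ = ENNReal.ofReal (2 / 3 * ∫ u in (0 : ℝ)..(2 * π), f u) := by
        rw [← ofReal_integral_eq_lintegral_ofReal
          (hf.integrableOn_Icc.mono_set Ico_subset_Icc_self) (Eventually.of_forall hf0),
          integral_Ico_eq_integral_Ioc, ← intervalIntegral.integral_of_le Real.two_pi_pos.le,
          mul_comm, ENNReal.ofReal_mul (by norm_num)]

namespace IsEnclosedRegion

variable {γ : ℝ → E3} {Ω : Set S2} (hΩ : IsEnclosedRegion γ Ω) (hγ : IsSmoothSimpleClosed γ)
  (hk : ∀ u, 0 < geodesicCurvature γ u)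
include hΩ hγ hk

lemma volume_image_tangentMap : volume (tangentMap γ '' tangentDomain) =
    ENNReal.ofReal (2 / 3 * arcIntegral γ (geodesicCurvature γ)) := by
  have hnonneg : ∀ u, 0 ≤ geodesicCurvature γ u * speed γ u := fun u =>
    mul_nonneg (hk u).le (hγ.speed_pos u).le
  rw [← lintegral_abs_det_fderiv_eq_addHaar_image volume measurableSet_tangentDomain
    (fun p _ => (hγ.hasFDerivAt_tangentMap p).hasFDerivWithinAt) (hΩ.injOn_tangentMap hγ hk),
    arcIntegral, ← lintegral_tangentDomain (f := fun u => geodesicCurvature γ u * speed γ u)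
      (hγ.continuous_geodesicCurvature.mul hγ.contDiff_speed.continuous) hnonneg]
  refine setLIntegral_congr_fun measurableSet_tangentDomain fun p hp => ?_
  rw [hγ.det_tangentMapDeriv, abs_of_nonneg (mul_nonneg hp.2.1.le (hnonneg _))]

lemma image_tangentMap_subset :
    tangentMap γ '' tangentDomain ⊆ ball 0 1 \ (openCone Ω ∪ -openCone Ω) := by
  rintro _ ⟨p, hp, rfl⟩
  refine ⟨hγ.tangentMap_mem_ball hp, ?_⟩
  rintro (hC | hC)
  · exact (hΩ.inner_normal_pos hγ hk hC (p 0)).ne' (inner_tangentMap_normal γ p)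
  · refine (hΩ.inner_normal_pos hγ hk hC (p 0)).ne' ?_
    rw [inner_neg_left, inner_tangentMap_normal, neg_zero]

lemma ball_diff_subset : ball 0 1 \ (openCone Ω ∪ -openCone Ω) ⊆
    tangentMap γ '' tangentDomain ∪ (frontier (openCone Ω) ∪ -frontier (openCone Ω) ∪ {0}) := by
  rintro x ⟨hx, hC⟩
  rw [mem_union, not_or] at hC
  by_cases hline : ∀ u, ∀ r : ℝ, x ≠ r • γ u
  · exact Or.inl (hΩ.mem_image_tangentMap hγ hk hx hC.1 hC.2 hline)
  push Not at hline
  obtain ⟨u, r, rfl⟩ := hline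
  have hfr : ∀ ρ > (0 : ℝ), ρ • γ u ∈ frontier (openCone Ω) := fun ρ hρ =>
    (hΩ.mem_frontier_openCone_iff hγ (smul_ne_zero hρ.ne' (hγ.curve_ne_zero u))).2 ⟨u, ρ, hρ, rfl⟩
  right
  obtain hr | rfl | hr := lt_trichotomy r 0
  · refine Or.inl (Or.inr ?_)
    rw [Set.mem_neg, ← neg_smul]
    exact hfr _ (neg_pos.2 hr)
  · exact Or.inr (zero_smul ℝ _)
  · exact Or.inl (Or.inl (hfr r hr))

lemma volume_ball_diff : volume (ball 0 1 \ (openCone Ω ∪ -openCone Ω)) =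
    ENNReal.ofReal (2 / 3 * arcIntegral γ (geodesicCurvature γ)) := by
  have hfr : volume (frontier (openCone Ω)) = 0 := (hΩ.convex_openCone hγ hk).addHaar_frontier _
  have hnull : volume (frontier (openCone Ω) ∪ -frontier (openCone Ω) ∪ {0}) = 0 :=
    measure_union_null (measure_union_null hfr (by rwa [Measure.measure_neg]))
      (measure_singleton 0)
  rw [← hΩ.volume_image_tangentMap hγ hk]
  exact ((measure_mono (hΩ.ball_diff_subset hγ hk)).trans_eq
    (measure_congr (union_ae_eq_left_of_ae_eq_empty (ae_eq_empty.2 hnull)))).antisymm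
      (measure_mono (hΩ.image_tangentMap_subset hγ hk))

lemma disjoint_neg_openCone : Disjoint (openCone Ω) (-openCone Ω) := by
  refine disjoint_left.2 fun x hx hx' => ?_
  have h := hΩ.inner_normal_pos hγ hk hx' 0
  rw [inner_neg_left, neg_pos] at h
  exact (h.trans (hΩ.inner_normal_pos hγ hk hx 0)).false

lemma measureReal_ball_inter_union_neg :
    volume.real (ball 0 1 ∩ (openCone Ω ∪ -openCone Ω)) =
      2 * volume.real (openCone Ω ∩ ball 0 1) := by
  have hneg : ball 0 1 ∩ -openCone Ω = -(openCone Ω ∩ ball 0 1) := by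
    rw [inter_neg, neg_ball, neg_zero, inter_comm]
  have hdisj : Disjoint (ball 0 1 ∩ openCone Ω) (ball 0 1 ∩ -openCone Ω) :=
    (hΩ.disjoint_neg_openCone hγ hk).mono inter_subset_right inter_subset_right
  have hvol : volume.real (ball 0 1 ∩ -openCone Ω) = volume.real (openCone Ω ∩ ball 0 1) := by
    rw [hneg, measureReal_def, Measure.measure_neg, measureReal_def]
  rw [inter_union_distrib_left, measureReal_union hdisj
    (isOpen_ball.measurableSet.inter hΩ.isOpen_openCone.measurableSet.neg),
    hvol, inter_comm, two_mul]

theorem area_eq_two_pi_sub : area Ω = 2 * π - arcIntegral γ (geodesicCurvature γ) := by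
  have harea : area Ω = 3 * volume.real (openCone Ω ∩ ball 0 1) := by
    simpa [area, measureReal_def] using
      toSphere_real_eq_measureReal_openCone volume hΩ.isOpen.measurableSet
  have hcurv : 0 ≤ arcIntegral γ (geodesicCurvature γ) :=
    intervalIntegral.integral_nonneg Real.two_pi_pos.le fun u _ =>
      mul_nonneg (hk u).le (hγ.speed_pos u).le
  have hdiff : volume.real (ball 0 1 \ (openCone Ω ∪ -openCone Ω)) =
      2 / 3 * arcIntegral γ (geodesicCurvature γ) := by
    rw [measureReal_def, hΩ.volume_ball_diff hγ hk, ENNReal.toReal_ofReal (by positivity)]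
  have hball : volume.real (ball (0 : E3) 1) = π * 4 / 3 := by
    rw [measureReal_def, EuclideanSpace.volume_ball_fin_three, ENNReal.ofReal_one, one_pow,
      one_mul, ENNReal.toReal_ofReal (by positivity)]
  have hsplit := measureReal_inter_add_sdiff (μ := volume) (s := ball (0 : E3) 1)
    (hΩ.isOpen_openCone.measurableSet.union hΩ.isOpen_openCone.measurableSet.neg)
  rw [hΩ.measureReal_ball_inter_union_neg hγ hk, hdiff, hball] at hsplit
  linarith

end IsEnclosedRegion

namespace IsSmoothSimpleClosed

variable {γ : ℝ → E3} (hγ : IsSmoothSimpleClosed γ)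
include hγ

lemma sq_length_add_sq_arcIntegral_le :
    length γ ^ 2 + arcIntegral γ (geodesicCurvature γ) ^ 2
        + length γ / (1 + supCurvature γ ^ 2)
          * arcIntegral γ (fun u => (geodesicCurvature γ u - meanCurvature γ) ^ 2)
      ≤ arcIntegral γ (fun u => √(1 + geodesicCurvature γ u ^ 2)) ^ 2 := by
  have := hγ.isFiniteMeasure_arcMeasure
  simp only [hγ.meanCurvature_eq_average, hγ.length_eq_measureReal, hγ.arcIntegral_eq_integral]
  exact variance_le_sq_integral_sqrt hγ.continuous_geodesicCurvature.aestronglyMeasurable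
    (Eventually.of_forall hγ.abs_geodesicCurvature_le)

lemma sq_arcIntegral_sqrt_eq_iff :
    arcIntegral γ (fun u => √(1 + geodesicCurvature γ u ^ 2)) ^ 2 =
        length γ ^ 2 + arcIntegral γ (geodesicCurvature γ) ^ 2
          + length γ / (1 + supCurvature γ ^ 2)
            * arcIntegral γ (fun u => (geodesicCurvature γ u - meanCurvature γ) ^ 2) ↔
      IsGeodesicCircle γ := by
  have := hγ.isFiniteMeasure_arcMeasure
  rw [hγ.isGeodesicCircle_iff]
  simp only [hγ.meanCurvature_eq_average, hγ.length_eq_measureReal, hγ.arcIntegral_eq_integral]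
  rw [sq_integral_sqrt_eq_iff hγ.continuous_geodesicCurvature.aestronglyMeasurable
    (Eventually.of_forall hγ.abs_geodesicCurvature_le)]
  constructor
  · exact fun h => ⟨_, hγ.eq_const_of_ae_arcMeasure hγ.continuous_geodesicCurvature
      hγ.periodic_geodesicCurvature h⟩
  · rintro ⟨κ, hκ⟩
    simp only [funext hκ]
    rcases eq_or_ne (arcMeasure γ) 0 with h0 | h0
    · rw [h0, ae_zero]
      exact eventually_bot
    · have : NeZero (arcMeasure γ) := ⟨h0⟩
      rw [average_const]

end IsSmoothSimpleClosed

end SphericalCurve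

end

theorem mainTheorem4 (γ : ℝ → SphericalCurve.E3) (Ω : Set SphericalCurve.S2)
    (hγ : SphericalCurve.IsSmoothSimpleClosed γ)
    (hΩ : SphericalCurve.IsEnclosedRegion γ Ω)
    (hk : ∀ u, 0 < SphericalCurve.geodesicCurvature γ u)
    (L A : ℝ) (hL : L = SphericalCurve.length γ) (hA : A = SphericalCurve.area Ω)
    (k : ℝ → ℝ) (hkg : k = SphericalCurve.geodesicCurvature γ) :
    L ^ 2 - A * (4 * Real.pi - A) ≤
        (SphericalCurve.arcIntegral γ fun u => Real.sqrt (1 + k u ^ 2)) ^ 2 - 4 * Real.pi ^ 2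
          - L / (1 + SphericalCurve.supCurvature γ ^ 2)
            * (SphericalCurve.arcIntegral γ fun u => (k u - SphericalCurve.meanCurvature γ) ^ 2) ∧
      (L ^ 2 - A * (4 * Real.pi - A) =
        (SphericalCurve.arcIntegral γ fun u => Real.sqrt (1 + k u ^ 2)) ^ 2 - 4 * Real.pi ^ 2
          - L / (1 + SphericalCurve.supCurvature γ ^ 2)
            * (SphericalCurve.arcIntegral γ fun u => (k u - SphericalCurve.meanCurvature γ) ^ 2) ↔
        SphericalCurve.IsGeodesicCircle γ) := by
  subst hL hA hkg
  have hle := hγ.sq_length_add_sq_arcIntegral_le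
  have hGB : SphericalCurve.area Ω = 2 * Real.pi
      - SphericalCurve.arcIntegral γ (SphericalCurve.geodesicCurvature γ) :=
    hΩ.area_eq_two_pi_sub hγ hk
  rw [← hγ.sq_arcIntegral_sqrt_eq_iff, hGB]
  exact ⟨by linarith, fun h => by linarith, fun h => by linarith⟩
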